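/- Let $\mathbb S^3$ be the unit sphere of $\mathbb R^4$. A compact boundary-free oriented polyhedral surface $P$ in $\mathbb S^3$ is given by a finite simplicial complex $K$ that triangulates a non-empty closed oriented surface, together with a map $x$ from the vertices of $K$ to $\mathbb S^3$ such that the three vertices of every triangle of $K$ are mapped to linearly independent vectors; every triangle of $K$ is then mapped to the geodesic triangle of $\mathbb S^3$ spanned by the images of its vertices. (A polygonal face is divided into triangles, if necessary with additional vertices; the dihedral angles at the additional edges equal $\pi$.) Selfintersections are allowed. A smooth deformation of $P$ over an interval $I\subset\mathbb R$ is a family $(P_t)_{t\in I}$ of such surfaces with the same $K$, whose vertices $x_t(v)$ are continuously differentiable functions of $t$. It leaves the dihedral angles fixed if for every edge of $K$ the dihedral angle of $P_t$ at this edge, measured in $[0,2\pi)$ on the negative side of the oriented surface, does not depend on $t\in I$. For a point $q\in\mathbb S^3$ that lies on the great sphere of no triangle of $P$, let $V_q(P)$ be the sum, over all triangles $\Delta$ of $P$, of the volumes of the spherical tetrahedra with apex $q$ and base $\Delta$, each taken with the sign of its orientation (positive if $q$ lies on the negative side of $\Delta$). The class of $V_q(P)$ modulo $2\pi^2=\operatorname{vol}\mathbb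 S^3$ is the (generalized) oriented volume bounded by $P$. **Theorem.** For every compact boundary-free oriented polyhedral surface in $\mathbb S^3$ and every smooth deformation $(P_t)_{t\in I}$ of it that leaves the dihedral angles fixed, the volume bounded by $P_t$ remains constant in the course of the deformation. That is: (a) $V_p(P_s)\equiv V_q(P_t) \pmod{2\pi^2}$ for all $s,t\in I$ and all $p,q\in\mathbb S^3$ for which the two sides are defined; (b) if for every $t\in I$ the surface $P_t$ has no selfintersections and bounds an open set $D_t\subset\mathbb S^3$ (the topological boundary of $D_t$ is $P_t$, and near each interior point of a triangle the set $D_t$ is the negative side of this triangle), then $\operatorname{vol}(D_s)=\operatorname{vol}(D_t)$ for all $s,t\in I$. -/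

import Mathlib

open scoped RealInnerProductSpace ENNReal Topology

noncomputable section

/-- Euclidean four-space, the ambient space of the unit three-sphere. -/
abbrev E4 : Type := EuclideanSpace ℝ (Fin 4)

/-- The spherical 3-space: the unit sphere of Euclidean four-space. -/
abbrev S3 : Type := Metric.sphere (0 : E4) 1

/-- The Riemannian volume of the spherical 3-space (the surface measure of the unit sphere);
the total volume is `2 * π ^ 2`. -/
def sphereVolume : MeasureTheory.Measure S3 :=
  (MeasureTheory.volume : MeasureTheory.Measure E4).toSphere

/-- The determinant of four vectors of four-space, taken as the rows of a matrix. -/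
def det4 (p q r s : S3) : ℝ :=
  (Matrix.of fun i j : Fin 4 => ((![p, q, r, s] i : S3) : E4) j).det

/-- The spherical hull of a set of points: the part of the sphere in the convex cone that the
points generate. For two, three or four linearly independent points it is the geodesic segment,
the spherical triangle or the spherical tetrahedron with these vertices. -/
def sphericalHull (A : Set S3) : Set S3 :=
  {y | (y : E4) ∈ Submodule.span NNReal ((fun a : S3 => (a : E4)) '' A)}

/-- A finite triangulation (an abstract simplicial complex with vertex set `V` and set of
triangles `F`) of a closed oriented surface. The triangle `f` has the vertices
`vert f 0, vert f 1, vert f 2`, listed in the positive cyclic order. -/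
structure OrientedTriangulation (V F : Type*) where
  /-- The vertices of a triangle. -/
  vert : F → Fin 3 → V
  /-- The three vertices of a triangle are different. -/
  vert_injective : ∀ f, Function.Injective (vert f)
  /-- A triangle is determined by its set of vertices. -/
  eq_of_range_eq : ∀ f g, Set.range (vert f) = Set.range (vert g) → f = g
  /-- Every vertex belongs to a triangle. -/
  exists_vert_eq : ∀ v, ∃ f i, vert f i = v
  /-- Every directed edge occurs in at most one triangle. -/
  edge_injective :
    Function.Injective fun h : F × Fin 3 => (vert h.1 h.2, vert h.1 (h.2 + 1))
  /-- There is no boundary, and the orientations of neighbouring triangles agree: the reverse of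
  every directed edge of a triangle is a directed edge of a triangle. -/
  exists_opposite : ∀ f i, ∃ g j, vert g j = vert f (i + 1) ∧ vert g (j + 1) = vert f i
  /-- The link of every vertex is one cycle: any two corners at the same vertex are joined by
  rotating about the vertex from one triangle to the next. -/
  link_connected : ∀ h k : F × Fin 3, vert h.1 h.2 = vert k.1 k.2 →
    Relation.ReflTransGen
      (fun h k : F × Fin 3 =>
        vert k.1 k.2 = vert h.1 h.2 ∧ vert k.1 (k.2 + 1) = vert h.1 (h.2 + 2)) h k

/-- The dihedral angle, in `[0, 2π)`, at the common edge `a b` of the positively oriented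
triangles `(a, b, c)` and `(b, a, d)`. In the plane orthogonal to `a` and `b` it is the angle
of the rotation that takes the direction of the first triangle to the direction of the second
one and that starts into the negative side of the first triangle. The negative side of
`(a, b, c)` is the set of all `z` with `det4 a b c z < 0`. -/
def dihedralAngle (a b c d : S3) : ℝ :=
  let proj : E4 → E4 := fun v => (Submodule.span ℝ {(a : E4), (b : E4)})ᗮ.starProjection v
  toIcoMod Real.two_pi_pos 0
    (Complex.arg ⟨√(1 - ⟪(a : E4), (b : E4)⟫ ^ 2) * ⟪proj c, proj d⟫, -det4 a b c d⟩)

namespace OrientedTriangulation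

variable {V F : Type*} (K : OrientedTriangulation V F)

/-- The triangle of the polyhedral surface in the sphere that belongs to `f`, when the vertices
are placed by `x`. -/
def face (x : V → S3) (f : F) : Set S3 :=
  sphericalHull (x '' Set.range (K.vert f))

/-- The relative interior of a triangle of the surface. -/
def openFace (x : V → S3) (f : F) : Set S3 :=
  {y | ∃ r : Fin 3 → ℝ, (∀ i, 0 < r i) ∧ (y : E4) = ∑ i, r i • (x (K.vert f i) : E4)}

/-- The set of all points of the surface. -/
def carrier (x : V → S3) : Set S3 := ⋃ f, K.face x f

/-- Four-dimensional determinant of the vertices of a triangle and a further point. It is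
negative on the negative side of the triangle. -/
def side (x : V → S3) (f : F) (z : S3) : ℝ :=
  det4 (x (K.vert f 0)) (x (K.vert f 1)) (x (K.vert f 2)) z

/-- No triangle of the surface is degenerate. Together with the triangulation, such a placement
of the vertices is a compact oriented polyhedral surface without boundary in the spherical
3-space; selfintersections are allowed. -/
def IsNondegenerate (x : V → S3) : Prop :=
  ∀ f, LinearIndependent ℝ fun i : Fin 3 => (x (K.vert f i) : E4)

/-- The surface has no selfintersections: any two triangles meet in the simplex that is spanned
by their common vertices only. -/
def IsEmbedded (x : V → S3) : Prop :=
  ∀ f g, K.face x f ∩ K.face x g ⊆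
    sphericalHull (x '' (Set.range (K.vert f) ∩ Set.range (K.vert g)))

/-- A smooth deformation over the time interval `I`: the vertices move continuously
differentiably and no triangle degenerates. -/
def IsSmoothDeformation (I : Set ℝ) (x : ℝ → V → S3) : Prop :=
  (∀ v, ContDiffOn ℝ 1 (fun t => (x t v : E4)) I) ∧ ∀ t ∈ I, K.IsNondegenerate (x t)

/-- The dihedral angle at every edge is constant in the course of the deformation. -/
def PreservesDihedralAngles (I : Set ℝ) (x : ℝ → V → S3) : Prop :=
  ∀ f i g j, K.vert g j = K.vert f (i + 1) → K.vert g (j + 1) = K.vert f i →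
    ∀ s ∈ I, ∀ t ∈ I,
      dihedralAngle (x s (K.vert f i)) (x s (K.vert f (i + 1)))
          (x s (K.vert f (i + 2))) (x s (K.vert g (j + 2))) =
        dihedralAngle (x t (K.vert f i)) (x t (K.vert f (i + 1)))
          (x t (K.vert f (i + 2))) (x t (K.vert g (j + 2)))

/-- The domain `D` is bounded by the (embedded) surface, and the surface carries the orientation
of the boundary of `D`: near each interior point of a triangle, `D` is the negative side of the
triangle. -/
structure Bounds (x : V → S3) (D : Set S3) : Prop where
  isOpen : IsOpen D
  frontier_eq : frontier D = K.carrier x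
  orientation : ∀ f, ∀ y ∈ K.openFace x f, ∀ᶠ z in 𝓝 y, (z ∈ D ↔ K.side x f z < 0)

/-- The apex `q` is in general position with respect to the surface: it lies on the great sphere
of no triangle. -/
def IsGeneric (x : V → S3) (q : S3) : Prop :=
  ∀ f, K.side x f q ≠ 0

/-- The oriented volume that is bounded by the surface, calculated with the apex `q`: the sum
over all triangles of the volumes of the spherical tetrahedra with apex `q` over them, each with
the sign of the orientation of the tetrahedron. For `q` in general position its class modulo the
volume `2 * π ^ 2` of the whole space does not depend on `q`. -/
def orientedVolume [Fintype F] (x : V → S3) (q : S3) : ℝ :=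
  ∑ f, SignType.sign (-K.side x f q) *
    sphereVolume.real (sphericalHull (insert q (x '' Set.range (K.vert f))))

end OrientedTriangulation

end

open scoped RealInnerProductSpace ENNReal Topology

noncomputable section

open MeasureTheory

/-! The theorem follows from Schläfli's principle: the variation of the volume is a sum over edges
of length times variation of the dihedral angle, hence vanishes if the angles are fixed. The proof
replaces spherical volumes by Gaussian integrals over cones. The Gaussian is radial, so the oriented
volume of a tetrahedron is, up to the constant factor `radialIntegral`, the determinant of its
vertices times `coneIntegral` (`sphereVolume_sphericalHull`). Integration by parts shows that the
first variation of this product is a flux through the facets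
(`hasFDerivAt_rowDet_mul_coneIntegral`).

For the tetrahedra with a fixed apex over a closed surface, the fluxes through the side faces cancel
in pairs. The flux through a base involves the first moments of the Gaussian on a three-dimensional
cone. These solve a Gram system whose right-hand side consists of the integrals over the edges, so
the flux splits into edge terms: edge integral times rotation rate of the triangle about the edge
(`baseFlux_eq`). The two triangles at an edge have equal rates if the dihedral angle is fixed
(`edgeRate_eq_of_dihedral`), and their terms cancel because they traverse the edge in opposite
directions. Hence the volume with a fixed apex is constant while the apex stays in general position.

A change of apex alters the volume by a multiple of the volume of the sphere, since the boundary of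
a 4-simplex covers almost every point of the sphere with the same total sign
(`exists_sum_alternating_orientedTetra`). Thus the class is locally constant on the interval. For an
embedded surface, the signed number of tetrahedra over a generic `z` is found by following the arc
from `z` to `-q` (`sum_sign_indicator_tetra`). It identifies the class with that of `vol D`, and
`vol D` lies in `(0, 2π²]`, where the class determines the number. -/

/-! ### Gaussian decay and integration by parts on the orthant. -/

/-- Lebesgue measure on the nonnegative orthant of `ℝⁿ`. -/
def orthantMeasure (n : ℕ) : Measure (Fin n → ℝ) :=
  Measure.pi fun _ => (volume : Measure ℝ).restrict (Set.Ici 0)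

instance (n : ℕ) : SigmaFinite (orthantMeasure n) := by
  unfold orthantMeasure; infer_instance

/-- The function is bounded by a multiple of a centred Gaussian. -/
def HasGaussianDecay {n : ℕ} (f : (Fin n → ℝ) → ℝ) : Prop :=
  ∃ c > 0, ∃ K, ∀ r, |f r| ≤ K * Real.exp (-c * ∑ i, r i ^ 2)

theorem integrable_exp_neg_sum_sq {n : ℕ} {c : ℝ} (hc : 0 < c) :
    Integrable (fun r : Fin n → ℝ => Real.exp (-c * ∑ i, r i ^ 2)) (orthantMeasure n) := by
  have h := Integrable.fintype_prod (ι := Fin n) (E := ℝ)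
    (f := fun _ (x : ℝ) => Real.exp (-c * x ^ 2))
    (μ := fun _ => (volume : Measure ℝ).restrict (Set.Ici 0))
    (fun _ => (integrable_exp_neg_mul_sq hc).integrableOn)
  refine h.congr (Filter.Eventually.of_forall fun r => ?_)
  simp only [Finset.mul_sum, Real.exp_sum]

theorem HasGaussianDecay.integrable {n : ℕ} {f : (Fin n → ℝ) → ℝ} (h : HasGaussianDecay f)
    (hf : Continuous f) : Integrable f (orthantMeasure n) := by
  obtain ⟨c, hc, K, hK⟩ := h
  exact ((integrable_exp_neg_sum_sq hc).const_mul K).mono' hf.aestronglyMeasurable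
    (Filter.Eventually.of_forall fun r => hK r)

theorem HasGaussianDecay.sub {n : ℕ} {f g : (Fin n → ℝ) → ℝ} (hf : HasGaussianDecay f)
    (hg : HasGaussianDecay g) : HasGaussianDecay fun r => f r - g r := by
  obtain ⟨c, hc, K, hK⟩ := hf
  obtain ⟨d, hd, L, hL⟩ := hg
  refine ⟨min c d, lt_min hc hd, |K| + |L|, fun r => ?_⟩
  have hS : 0 ≤ ∑ i, r i ^ 2 := Finset.sum_nonneg fun i _ => sq_nonneg _
  have h1 : Real.exp (-c * ∑ i, r i ^ 2) ≤ Real.exp (-(min c d) * ∑ i, r i ^ 2) :=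
    Real.exp_le_exp.2 (mul_le_mul_of_nonneg_right (neg_le_neg (min_le_left _ _)) hS)
  have h2 : Real.exp (-d * ∑ i, r i ^ 2) ≤ Real.exp (-(min c d) * ∑ i, r i ^ 2) :=
    Real.exp_le_exp.2 (mul_le_mul_of_nonneg_right (neg_le_neg (min_le_right _ _)) hS)
  calc |f r - g r| ≤ |f r| + |g r| := abs_sub _ _
    _ ≤ K * Real.exp (-c * ∑ i, r i ^ 2) + L * Real.exp (-d * ∑ i, r i ^ 2) :=
        add_le_add (hK r) (hL r)
    _ ≤ |K| * Real.exp (-c * ∑ i, r i ^ 2) + |L| * Real.exp (-d * ∑ i, r i ^ 2) := by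
        gcongr <;> exact le_abs_self _
    _ ≤ |K| * Real.exp (-(min c d) * ∑ i, r i ^ 2)
        + |L| * Real.exp (-(min c d) * ∑ i, r i ^ 2) := by gcongr
    _ = _ := by ring

/-- Half of the exponent absorbs the polynomial factor, because `exp (c x / 2) ≥ 1 + c x / 2`. -/
theorem one_add_mul_exp_le {c x : ℝ} (hc : 0 < c) (hx : 0 ≤ x) :
    (1 + x) * Real.exp (-c * x) ≤ (1 + 2 / c) * Real.exp (-(c / 2) * x) := by
  have h1 : 1 + x ≤ (1 + 2 / c) * Real.exp (c / 2 * x) := by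
    have h2 := Real.add_one_le_exp (c / 2 * x)
    have h3 : x = 2 / c * (c / 2 * x) := by field_simp
    have h4 : (0 : ℝ) < 2 / c := by positivity
    have h5 : 0 ≤ c / 2 * x := by positivity
    nlinarith
  calc (1 + x) * Real.exp (-c * x)
      ≤ (1 + 2 / c) * Real.exp (c / 2 * x) * Real.exp (-c * x) := by gcongr
    _ = _ := by rw [mul_assoc, ← Real.exp_add]; congr 2; ring

/-- Integration by parts in the `j`-th coordinate of the orthant. -/
theorem integral_orthant_partial_deriv {n : ℕ} (j : Fin (n + 1)) {f f' : (Fin (n + 1) → ℝ) → ℝ}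
    (hf : HasGaussianDecay f) (hf' : Integrable f' (orthantMeasure (n + 1)))
    (hd : ∀ (r : Fin n → ℝ) s, HasDerivAt (fun s => f (j.insertNth s r)) (f' (j.insertNth s r)) s) :
    ∫ r, f' r ∂orthantMeasure (n + 1) = -∫ r, f (j.insertNth 0 r) ∂orthantMeasure n := by
  have hmp := (measurePreserving_piFinSuccAbove (α := fun _ : Fin (n + 1) => ℝ)
    (fun _ => (volume : Measure ℝ).restrict (Set.Ici 0)) j).symm
  have e1 := hmp.integral_comp' f'
  have i1 := (hmp.integrable_comp_emb (MeasurableEquiv.measurableEmbedding _) (g := f')).2 hf'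
  unfold orthantMeasure
  rw [← e1]
  refine (integral_prod_symm _ i1).trans ?_
  rw [← integral_neg]
  refine integral_congr_ae ?_
  filter_upwards [i1.prod_left_ae] with r hr
  rw [integral_Ici_eq_integral_Ioi]
  have hz : Filter.Tendsto (fun s => f (j.insertNth s r)) Filter.atTop (𝓝 0) := by
    obtain ⟨c, hc, K, hK⟩ := hf
    have hlim : Filter.Tendsto (fun s : ℝ => |K| * Real.exp (-c * s ^ 2)) Filter.atTop (𝓝 0) := by
      rw [← mul_zero |K|]
      refine Filter.Tendsto.const_mul _ (Real.tendsto_exp_atBot.comp ?_)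
      exact (Filter.tendsto_pow_atTop two_ne_zero).const_mul_atTop_of_neg (neg_lt_zero.2 hc)
    refine squeeze_zero_norm (fun s => (hK _).trans ?_) hlim
    gcongr ?_ * Real.exp ?_
    · exact le_abs_self K
    · refine mul_le_mul_of_nonpos_left ?_ (by linarith)
      rw [Fin.sum_univ_succAbove _ j]
      simp only [Fin.insertNth_apply_same]
      exact le_add_of_nonneg_right (Finset.sum_nonneg fun i _ => sq_nonneg _)
  have := integral_Ioi_of_hasDerivAt_of_tendsto' (a := 0) (fun s _ => hd r s) ?_ hz
  · rw [zero_sub] at this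
    exact this
  · exact hr.mono_measure (Measure.restrict_mono Set.Ioi_subset_Ici_self le_rfl)

/-! ### Gaussian integrals and moments on simplicial cones, and their dependence on the generators.
-/

section Gauss

variable {E : Type*} [NormedAddCommGroup E] [InnerProductSpace ℝ E] {n : ℕ}

/-- The Gaussian `exp (-|x|² / 2)` at the point `x` with the coordinates `r` with respect
to `v`. -/
def gaussWeight (v : Fin n → E) (r : Fin n → ℝ) : ℝ := Real.exp (-(‖∑ i, r i • v i‖ ^ 2 / 2))

/-- The integral of the Gaussian over the cone spanned by `v`, with respect to the coordinates. -/
def coneIntegral (v : Fin n → E) : ℝ := ∫ r, gaussWeight v r ∂orthantMeasure n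

/-- The first moment, in the `k`-th coordinate, of the Gaussian on the cone spanned by `v`. -/
def coneMoment (v : Fin n → E) (k : Fin n) : ℝ := ∫ r, r k * gaussWeight v r ∂orthantMeasure n

theorem continuous_gaussWeight (v : Fin n → E) : Continuous (gaussWeight v) := by
  unfold gaussWeight; fun_prop

theorem gaussWeight_pos (v : Fin n → E) (r : Fin n → ℝ) : 0 < gaussWeight v r := Real.exp_pos _

/-- Linearly independent vectors stay uniformly independent under small perturbations. -/
theorem LinearIndependent.exists_nhds_lower_bound {v : Fin n → E} (hv : LinearIndependent ℝ v) :
    ∃ c > 0, ∀ᶠ u in 𝓝 v, ∀ r : Fin n → ℝ, c * ∑ i, r i ^ 2 ≤ ‖∑ i, r i • u i‖ ^ 2 / 2 := by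
  obtain ⟨K, hK0, hK⟩ := LinearMap.exists_antilipschitzWith (Fintype.linearCombination ℝ v)
    (LinearMap.ker_eq_bot.2 (linearIndependent_iff_injective_fintypeLinearCombination.1 hv))
  have hK0' : (0 : ℝ) < K := by exact_mod_cast hK0
  have hb : ∀ r : Fin n → ℝ, ‖r‖ ≤ K * ‖∑ i, r i • v i‖ := fun r => by
    simpa [Fintype.linearCombination_apply] using hK.le_mul_dist r 0
  -- A perturbation by `d` moves `∑ r i • v i` by at most `‖r‖ / (2K)`, half of the lower bound `‖r‖
  -- / K`. The denominator has `n + 1` so that it is nonzero for `n = 0`.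
  set d : ℝ := 1 / (2 * K * (n + 1))
  have hd : 0 < d := by positivity
  refine ⟨(1 / (2 * K)) ^ 2 / 2 / (n + 1), by positivity, ?_⟩
  filter_upwards [Metric.ball_mem_nhds v hd] with u hu r
  have h1 : ‖∑ i, r i • (v i - u i)‖ ≤ n * (‖r‖ * d) := by
    refine (norm_sum_le _ _).trans ((Finset.sum_le_sum (g := fun _ => ‖r‖ * d)
      fun i _ => ?_).trans_eq (by simp))
    rw [norm_smul]
    refine mul_le_mul (norm_le_pi_norm r i) ?_ (norm_nonneg _) (norm_nonneg _)
    rw [norm_sub_rev]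
    exact (norm_le_pi_norm (u - v) i).trans (by rw [← dist_eq_norm]; exact (Metric.mem_ball.1 hu).le)
  have h2 : ∑ i, r i • v i = ∑ i, r i • u i + ∑ i, r i • (v i - u i) := by
    rw [← Finset.sum_add_distrib]; congr 1; ext i; rw [← smul_add]; simp
  have h3 := norm_add_le (∑ i, r i • u i) (∑ i, r i • (v i - u i))
  rw [← h2] at h3
  have h4 : (n : ℝ) * (‖r‖ * d) ≤ ‖r‖ / (2 * K) := by
    have : (n : ℝ) * (‖r‖ * d) = ‖r‖ / (2 * K) * (n / (n + 1)) := by simp only [d]; field_simp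
    rw [this]
    refine mul_le_of_le_one_right (by positivity) ?_
    rw [div_le_one (by positivity)]; linarith
  have h5 : ‖r‖ / K ≤ ‖∑ i, r i • v i‖ := by
    rw [div_le_iff₀ hK0', mul_comm]; exact hb r
  have h6 : 1 / (2 * K) * ‖r‖ ≤ ‖∑ i, r i • u i‖ := by
    have : ‖r‖ / K = 1 / (2 * K) * ‖r‖ + ‖r‖ / (2 * K) := by field_simp; norm_num
    linarith
  have h7 : ∑ i, r i ^ 2 ≤ (n + 1) * ‖r‖ ^ 2 := by
    have : ∑ i, r i ^ 2 ≤ ∑ _i : Fin n, ‖r‖ ^ 2 := Finset.sum_le_sum fun i _ => by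
      rw [← sq_abs, ← Real.norm_eq_abs]
      gcongr
      exact norm_le_pi_norm r i
    simp at this
    nlinarith [sq_nonneg ‖r‖]
  calc (1 / (2 * K)) ^ 2 / 2 / (n + 1) * ∑ i, r i ^ 2
      ≤ (1 / (2 * K)) ^ 2 / 2 / (n + 1) * ((n + 1) * ‖r‖ ^ 2) := by gcongr
    _ = (1 / (2 * K) * ‖r‖) ^ 2 / 2 := by field_simp
    _ ≤ _ := by gcongr

theorem hasGaussianDecay_mul_gaussWeight {v : Fin n → E} (hv : LinearIndependent ℝ v)
    {p : (Fin n → ℝ) → ℝ} {K : ℝ} (hp : ∀ r, |p r| ≤ K * (1 + ∑ i, r i ^ 2)) :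
    HasGaussianDecay fun r => p r * gaussWeight v r := by
  obtain ⟨c, hc, h⟩ := hv.exists_nhds_lower_bound
  have h := h.self_of_nhds
  refine ⟨c / 2, by positivity, |K| * (1 + 2 / c), fun r => ?_⟩
  have hS : 0 ≤ ∑ i, r i ^ 2 := Finset.sum_nonneg fun i _ => sq_nonneg _
  rw [abs_mul, abs_of_pos (gaussWeight_pos v r)]
  calc |p r| * gaussWeight v r ≤ (|K| * (1 + ∑ i, r i ^ 2)) * Real.exp (-c * ∑ i, r i ^ 2) := by
        refine mul_le_mul ((hp r).trans ?_) ?_ (gaussWeight_pos v r).le (by positivity)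
        · gcongr; exact le_abs_self K
        · unfold gaussWeight
          have := h r
          gcongr; linarith
    _ = |K| * ((1 + ∑ i, r i ^ 2) * Real.exp (-c * ∑ i, r i ^ 2)) := by ring
    _ ≤ |K| * ((1 + 2 / c) * Real.exp (-(c / 2) * ∑ i, r i ^ 2)) := by
        exact mul_le_mul_of_nonneg_left (one_add_mul_exp_le hc hS) (abs_nonneg K)
    _ = _ := by ring

theorem abs_mul_coord_le (r : Fin n → ℝ) (i k : Fin n) : |r i * r k| ≤ ∑ i, r i ^ 2 := by
  have h1 : r i ^ 2 ≤ ∑ i, r i ^ 2 :=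
    Finset.single_le_sum (f := fun i => r i ^ 2) (fun i _ => sq_nonneg _) (Finset.mem_univ i)
  have h2 : r k ^ 2 ≤ ∑ i, r i ^ 2 :=
    Finset.single_le_sum (f := fun i => r i ^ 2) (fun i _ => sq_nonneg _) (Finset.mem_univ k)
  rw [abs_le]
  constructor <;> nlinarith [sq_nonneg (r i + r k), sq_nonneg (r i - r k)]

theorem abs_coord_le (r : Fin n → ℝ) (i : Fin n) : |r i| ≤ 1 + ∑ i, r i ^ 2 := by
  have h1 : r i ^ 2 ≤ ∑ i, r i ^ 2 :=
    Finset.single_le_sum (f := fun i => r i ^ 2) (fun i _ => sq_nonneg _) (Finset.mem_univ i)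
  rw [abs_le]
  constructor <;> nlinarith [sq_nonneg (r i + 1), sq_nonneg (r i - 1)]

theorem hasGaussianDecay_gaussWeight {v : Fin n → E} (hv : LinearIndependent ℝ v) :
    HasGaussianDecay (gaussWeight v) := by
  have := hasGaussianDecay_mul_gaussWeight hv (p := fun _ => 1) (K := 1) (fun r => by
    have hS : 0 ≤ ∑ i, r i ^ 2 := Finset.sum_nonneg fun i _ => sq_nonneg _
    simp [hS])
  simpa using this

theorem hasGaussianDecay_coord_mul {v : Fin n → E} (hv : LinearIndependent ℝ v) (i : Fin n) :
    HasGaussianDecay fun r => r i * gaussWeight v r :=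
  hasGaussianDecay_mul_gaussWeight hv (K := 1) fun r => by simpa using abs_coord_le r i

theorem hasGaussianDecay_coord_mul_inner {v : Fin n → E} (hv : LinearIndependent ℝ v) (i : Fin n)
    (w : E) : HasGaussianDecay fun r => r i * ⟪∑ k, r k • v k, w⟫ * gaussWeight v r := by
  refine hasGaussianDecay_mul_gaussWeight hv (K := ∑ k, |⟪v k, w⟫|) fun r => ?_
  have hS : 0 ≤ ∑ i, r i ^ 2 := Finset.sum_nonneg fun i _ => sq_nonneg _
  rw [sum_inner, Finset.mul_sum, Finset.sum_mul]
  refine (Finset.abs_sum_le_sum_abs _ _).trans (Finset.sum_le_sum fun k _ => ?_)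
  rw [real_inner_smul_left, ← mul_assoc, abs_mul, mul_comm]
  gcongr
  linarith [abs_mul_coord_le r i k]

theorem hasGaussianDecay_inner_mul {v : Fin n → E} (hv : LinearIndependent ℝ v)
    (w : E) : HasGaussianDecay fun r => ⟪∑ k, r k • v k, w⟫ * gaussWeight v r := by
  refine hasGaussianDecay_mul_gaussWeight hv (K := ∑ k, |⟪v k, w⟫|) fun r => ?_
  rw [sum_inner, Finset.sum_mul]
  refine (Finset.abs_sum_le_sum_abs _ _).trans (Finset.sum_le_sum fun k _ => ?_)
  rw [real_inner_smul_left, abs_mul, mul_comm]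
  gcongr
  exact abs_coord_le r k

theorem sum_insertNth_smul (v : Fin (n + 1) → E) (j : Fin (n + 1)) (s : ℝ) (r : Fin n → ℝ) :
    ∑ i, (j.insertNth s r : Fin (n + 1) → ℝ) i • v i
      = s • v j + ∑ i, r i • v (j.succAbove i) := by
  rw [Fin.sum_univ_succAbove _ j]; simp

theorem gaussWeight_insertNth_zero (v : Fin (n + 1) → E) (j : Fin (n + 1)) (r : Fin n → ℝ) :
    gaussWeight v (j.insertNth 0 r) = gaussWeight (fun i => v (j.succAbove i)) r := by
  unfold gaussWeight; rw [sum_insertNth_smul]; simp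

theorem hasDerivAt_gaussWeight_insertNth (v : Fin (n + 1) → E) (j : Fin (n + 1)) (r : Fin n → ℝ)
    (s : ℝ) : HasDerivAt (fun s => gaussWeight v (j.insertNth s r))
      (-(⟪∑ i, (j.insertNth s r : Fin (n + 1) → ℝ) i • v i, v j⟫
        * gaussWeight v (j.insertNth s r))) s := by
  unfold gaussWeight
  simp only [sum_insertNth_smul]
  have h1 : HasDerivAt (fun s : ℝ => s • v j + ∑ i, r i • v (j.succAbove i)) (v j) s := by
    simpa using ((hasDerivAt_id s).smul_const (v j)).add_const (∑ i, r i • v (j.succAbove i))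
  have h2 : HasDerivAt (fun s => -(‖s • v j + ∑ i, r i • v (j.succAbove i)‖ ^ 2 / 2)) _ s :=
    (h1.norm_sq.div_const 2).neg
  convert h2.exp using 1
  ring

/-- The integrand is minus the `j`-th partial derivative of the Gaussian, so only the facet `r j =
0` contributes. -/
theorem integral_inner_mul_gaussWeight {v : Fin (n + 1) → E} (hv : LinearIndependent ℝ v)
    (j : Fin (n + 1)) :
    ∫ r, ⟪∑ i, r i • v i, v j⟫ * gaussWeight v r ∂orthantMeasure (n + 1)
      = coneIntegral fun i => v (j.succAbove i) := by
  have h := integral_orthant_partial_deriv j (hasGaussianDecay_gaussWeight hv)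
    (f' := fun r => -(⟪∑ i, r i • v i, v j⟫ * gaussWeight v r)) ?_
    (fun r s => hasDerivAt_gaussWeight_insertNth v j r s)
  · rw [integral_neg, neg_inj] at h
    rw [h]
    simp only [gaussWeight_insertNth_zero]
    rfl
  · refine ((hasGaussianDecay_inner_mul hv (v j)).integrable ?_).neg
    have := continuous_gaussWeight v
    fun_prop

theorem continuous_coord_mul_inner (v : Fin n → E) (i : Fin n) (w : E) :
    Continuous fun r => r i * ⟪∑ k, r k • v k, w⟫ * gaussWeight v r := by
  have := continuous_gaussWeight v
  fun_prop

/-- Integration of the `j`-th derivative of `r j * gaussWeight v r`: the boundary term carries the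
factor `r j = 0`. -/
theorem integral_coord_mul_inner_self {v : Fin (n + 1) → E} (hv : LinearIndependent ℝ v)
    (j : Fin (n + 1)) :
    ∫ r, r j * ⟪∑ i, r i • v i, v j⟫ * gaussWeight v r ∂orthantMeasure (n + 1)
      = coneIntegral v := by
  have hi : Integrable (fun r => r j * ⟪∑ i, r i • v i, v j⟫ * gaussWeight v r)
      (orthantMeasure (n + 1)) :=
    (hasGaussianDecay_coord_mul_inner hv j (v j)).integrable (continuous_coord_mul_inner v j _)
  have hg := (hasGaussianDecay_gaussWeight hv).integrable (continuous_gaussWeight v)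
  have h := integral_orthant_partial_deriv j (hasGaussianDecay_coord_mul hv j)
    (f' := fun r => gaussWeight v r - r j * ⟪∑ i, r i • v i, v j⟫ * gaussWeight v r) ?_
    (fun r s => ?_)
  · rw [integral_sub hg hi] at h
    simp only [Fin.insertNth_apply_same, zero_mul, integral_zero, neg_zero, sub_eq_zero] at h
    exact h.symm
  · exact hg.sub hi
  · simp only [Fin.insertNth_apply_same]
    exact ((hasDerivAt_id s).mul (hasDerivAt_gaussWeight_insertNth v j r s)).congr_deriv
      (by simp; ring)

/-- Here the coordinate differs from the direction of integration by parts, so it survives on the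
facet and produces a first moment there. -/
theorem integral_coord_mul_inner_succAbove {v : Fin (n + 1) → E} (hv : LinearIndependent ℝ v)
    (j : Fin (n + 1)) (k : Fin n) :
    ∫ r, r (j.succAbove k) * ⟪∑ i, r i • v i, v j⟫ * gaussWeight v r ∂orthantMeasure (n + 1)
      = coneMoment (fun i => v (j.succAbove i)) k := by
  have h := integral_orthant_partial_deriv j (hasGaussianDecay_coord_mul hv (j.succAbove k))
    (f' := fun r => -(r (j.succAbove k) * ⟪∑ i, r i • v i, v j⟫ * gaussWeight v r)) ?_
    (fun r s => ?_)
  · rw [integral_neg, neg_inj] at h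
    rw [h]
    simp only [gaussWeight_insertNth_zero, Fin.insertNth_apply_succAbove]
    rfl
  · exact ((hasGaussianDecay_coord_mul_inner hv _ (v j)).integrable
      (continuous_coord_mul_inner v _ _)).neg
  · simp only [Fin.insertNth_apply_succAbove]
    exact ((hasDerivAt_gaussWeight_insertNth v j r s).const_mul (r k)).congr_deriv (by ring)

/-- The first moments solve a linear system whose matrix is the Gram matrix. -/
theorem sum_inner_mul_coneMoment {v : Fin (n + 1) → E} (hv : LinearIndependent ℝ v)
    (j : Fin (n + 1)) :
    ∑ k, ⟪v k, v j⟫ * coneMoment v k = coneIntegral fun i => v (j.succAbove i) := by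
  rw [← integral_inner_mul_gaussWeight hv j]
  unfold coneMoment
  simp_rw [← integral_const_mul]
  rw [← integral_finsetSum]
  · congr 1; ext r
    rw [sum_inner, Finset.sum_mul]
    refine Finset.sum_congr rfl fun k _ => ?_
    rw [real_inner_smul_left]; ring
  · intro k _
    refine ((hasGaussianDecay_coord_mul hv k).integrable ?_).const_mul _
    have := continuous_gaussWeight v
    fun_prop

/-- Differentiation under the integral sign. Near `h₀` the generators are uniformly independent,
which gives one integrable Gaussian majorant for all derivatives. -/
theorem hasFDerivAt_coneIntegral_comp {H : Type*} [NormedAddCommGroup H] [NormedSpace ℝ H]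
    (A : Fin n → H →L[ℝ] E) {h₀ : H} (hv : LinearIndependent ℝ fun i => A i h₀) :
    ∃ L : H →L[ℝ] ℝ, HasFDerivAt (fun h => coneIntegral fun i => A i h) L h₀ ∧ ∀ w, L w =
      -∑ i, ∫ r, r i * ⟪∑ k, r k • A k h₀, A i w⟫ * gaussWeight (fun i => A i h₀) r
        ∂orthantMeasure n := by
  obtain ⟨c, hc, hlow⟩ := hv.exists_nhds_lower_bound
  have hcA : Continuous fun h i => A i h := by fun_prop
  have hlow := hcA.continuousAt.eventually hlow
  -- `X r h` is the point of the cone with coordinates `r`; it is linear in the parameter `h`.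
  let X : (Fin n → ℝ) → H →L[ℝ] E := fun r => ∑ i, r i • A i
  have hX : ∀ r u, X r u = ∑ i, r i • A i u := fun r u => by simp [X]
  have hXc : Continuous X := by fun_prop
  let F' : H → (Fin n → ℝ) → H →L[ℝ] ℝ :=
    fun u r => -(gaussWeight (fun i => A i u) r • (innerSL ℝ (X r u)).comp (X r))
  have hF' : ∀ u r, HasFDerivAt (fun u => gaussWeight (fun i => A i u) r) (F' u r) u :=
      fun u r => by
    have h1 : HasFDerivAt (fun u => -(‖X r u‖ ^ 2 / 2))
        (-((innerSL ℝ (X r u)).comp (X r))) u := by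
      have h2 := (((X r).hasFDerivAt (x := u)).norm_sq.mul_const (1 / 2 : ℝ)).neg
      refine (h2.congr_fderiv ?_).congr_of_eventuallyEq
        (Filter.Eventually.of_forall fun u => by simp [div_eq_mul_inv])
      ext w; simp
    have h3 := h1.exp
    simp only [hX] at h3
    refine h3.congr_fderiv ?_
    ext w; simp [F', gaussWeight, hX]
  set B : ℝ := ∑ i, ‖A i‖
  have hB : 0 ≤ B := Finset.sum_nonneg fun i _ => norm_nonneg _
  have hXn : ∀ r, ‖X r‖ ≤ (∑ i, |r i|) * B := fun r => by
    rw [Finset.sum_mul]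
    refine (norm_sum_le _ _).trans (Finset.sum_le_sum fun i _ => ?_)
    rw [norm_smul, Real.norm_eq_abs]
    refine mul_le_mul_of_nonneg_left ?_ (abs_nonneg _)
    exact Finset.single_le_sum (f := fun i => ‖A i‖) (fun i _ => norm_nonneg _)
      (Finset.mem_univ i)
  have hsq : ∀ r : Fin n → ℝ, (∑ i, |r i|) ^ 2 ≤ n * ∑ i, r i ^ 2 := fun r => by
    simpa using sq_sum_le_card_mul_sum_sq (s := Finset.univ) (f := fun i => |r i|)
  have hcg : Continuous fun r => gaussWeight (fun i => A i h₀) r := continuous_gaussWeight _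
  have hX₀ : Continuous fun r => X r h₀ := by simp only [hX]; fun_prop
  have hFc : Continuous (F' h₀) :=
    (hcg.smul (((innerSL ℝ).continuous.comp hX₀).clm_comp hXc)).neg
  -- The derivative is at most `gaussWeight * ‖X r u‖ * ‖X r‖`, quadratic in `r` times a Gaussian of
  -- rate `c`. Bounding `‖u‖` makes the majorant independent of `u`.
  have hbound : ∀ u r, (∀ r : Fin n → ℝ, c * ∑ i, r i ^ 2 ≤ ‖∑ i, r i • A i u‖ ^ 2 / 2) →
      ‖u‖ ≤ ‖h₀‖ + 1 → ‖F' u r‖ ≤ n * (B ^ 2 * (‖h₀‖ + 1)) *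
        ((1 + 2 / c) * Real.exp (-(c / 2) * ∑ i, r i ^ 2)) := fun u r hu1 hu3 => by
    have hS : 0 ≤ ∑ i, r i ^ 2 := Finset.sum_nonneg fun i _ => sq_nonneg _
    have hA : 0 ≤ ∑ i, |r i| := Finset.sum_nonneg fun i _ => abs_nonneg _
    have hn : ‖F' u r‖ ≤ gaussWeight (fun i => A i u) r * (‖X r u‖ * ‖X r‖) := by
      simp only [F', norm_neg, norm_smul, Real.norm_eq_abs, abs_of_pos (gaussWeight_pos _ r)]
      refine mul_le_mul_of_nonneg_left ?_ (gaussWeight_pos _ r).le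
      refine (ContinuousLinearMap.opNorm_comp_le _ _).trans ?_
      rw [innerSL_apply_norm]
    have hg : gaussWeight (fun i => A i u) r ≤ Real.exp (-c * ∑ i, r i ^ 2) := by
      unfold gaussWeight
      have := hu1 r
      gcongr; linarith
    have hx : ‖X r u‖ ≤ (∑ i, |r i|) * B * (‖h₀‖ + 1) :=
      ((X r).le_opNorm u).trans (mul_le_mul (hXn r) hu3 (norm_nonneg _) (by positivity))
    calc ‖F' u r‖ ≤ Real.exp (-c * ∑ i, r i ^ 2)
          * (((∑ i, |r i|) * B * (‖h₀‖ + 1)) * ((∑ i, |r i|) * B)) :=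
          hn.trans (mul_le_mul hg (mul_le_mul hx (hXn r) (norm_nonneg _) (by positivity))
            (by positivity) (Real.exp_pos _).le)
      _ = (∑ i, |r i|) ^ 2 * (B ^ 2 * (‖h₀‖ + 1) * Real.exp (-c * ∑ i, r i ^ 2)) := by ring
      _ ≤ (n * (1 + ∑ i, r i ^ 2)) * (B ^ 2 * (‖h₀‖ + 1) * Real.exp (-c * ∑ i, r i ^ 2)) := by
          refine mul_le_mul_of_nonneg_right ((hsq r).trans ?_) (by positivity)
          gcongr; linarith
      _ = n * (B ^ 2 * (‖h₀‖ + 1)) *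
          ((1 + ∑ i, r i ^ 2) * Real.exp (-c * ∑ i, r i ^ 2)) := by ring
      _ ≤ _ := mul_le_mul_of_nonneg_left (one_add_mul_exp_le hc hS) (by positivity)
  have hbi : Integrable (fun r => n * (B ^ 2 * (‖h₀‖ + 1)) *
      ((1 + 2 / c) * Real.exp (-(c / 2) * ∑ i, r i ^ 2))) (orthantMeasure n) :=
    ((integrable_exp_neg_sum_sq (by positivity)).const_mul _).const_mul _
  have hint : HasFDerivAt (fun h => coneIntegral fun i => A i h)
      (∫ r, F' h₀ r ∂orthantMeasure n) h₀ := by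
    obtain ⟨s, hs, hsub⟩ := Filter.eventually_iff_exists_mem.1
      (hlow.and (Metric.ball_mem_nhds h₀ one_pos))
    refine hasFDerivAt_integral_of_dominated_of_fderiv_le hs
      (Filter.Eventually.of_forall fun u => (continuous_gaussWeight _).aestronglyMeasurable)
      ((hasGaussianDecay_gaussWeight hv).integrable hcg) hFc.aestronglyMeasurable
      (Filter.Eventually.of_forall fun r u hu => hbound u r (hsub u hu).1 ?_) hbi
      (Filter.Eventually.of_forall fun r u _ => hF' u r)
    have hu2 := mem_ball_iff_norm.1 (hsub u hu).2
    have := norm_sub_norm_le u h₀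
    linarith
  have hFi : Integrable (F' h₀) (orthantMeasure n) :=
    hbi.mono' hFc.aestronglyMeasurable (Filter.Eventually.of_forall fun r =>
      hbound h₀ r hlow.self_of_nhds (by linarith))
  refine ⟨_, hint, fun w => ?_⟩
  rw [ContinuousLinearMap.integral_apply hFi, ← integral_finsetSum, ← integral_neg]
  · congr 1; ext r
    simp only [F', hX, neg_apply, smul_apply,
      ContinuousLinearMap.comp_apply, innerSL_apply_apply, smul_eq_mul, inner_sum (𝕜 := ℝ)]
    rw [Finset.mul_sum]
    congr 1
    refine Finset.sum_congr rfl fun i _ => ?_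
    rw [real_inner_smul_right]; ring
  · exact fun i _ => (hasGaussianDecay_coord_mul_inner hv i (A i w)).integrable
      (continuous_coord_mul_inner _ i _)

/-- The integral of the Gaussian over a cone is differentiable in the generators. -/
theorem hasFDerivAt_coneIntegral {v : Fin n → E} (hv : LinearIndependent ℝ v) :
    ∃ L : (Fin n → E) →L[ℝ] ℝ, HasFDerivAt coneIntegral L v ∧ ∀ w, L w =
      -∑ i, ∫ r, r i * ⟪∑ k, r k • v k, w i⟫ * gaussWeight v r ∂orthantMeasure n :=
  hasFDerivAt_coneIntegral_comp
    (fun i => ContinuousLinearMap.proj (R := ℝ) (φ := fun _ : Fin n => E) i) hv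

end Gauss

/-! ### First variation of the oriented Gaussian volume. -/

/-- The determinant of `m` vectors of `ℝᵐ`, taken as the rows of a matrix. -/
def rowDet {m : ℕ} (v : Fin m → EuclideanSpace ℝ (Fin m)) : ℝ := (Matrix.of fun i j => v i j).det

theorem linearIndependent_iff_rowDet_ne_zero {m : ℕ} {v : Fin m → EuclideanSpace ℝ (Fin m)} :
    LinearIndependent ℝ v ↔ rowDet v ≠ 0 := by
  unfold rowDet
  rw [← isUnit_iff_ne_zero, ← Matrix.isUnit_iff_isUnit_det,
    ← Matrix.linearIndependent_rows_iff_isUnit]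
  exact (LinearMap.linearIndependent_iff_of_injOn
    (WithLp.linearEquiv 2 ℝ (Fin m → ℝ)).toLinearMap
    ((WithLp.linearEquiv 2 ℝ (Fin m → ℝ)).injective.injOn)).symm

/-- Cramer's rule without division. -/
theorem rowDet_smul_eq_sum {m : ℕ} (v : Fin m → EuclideanSpace ℝ (Fin m))
    (w : EuclideanSpace ℝ (Fin m)) :
    rowDet v • w = ∑ j, rowDet (Function.update v j w) • v j := by
  have h := Matrix.mulVec_cramer (Matrix.of fun i j => v i j).transpose (fun j => w j)
  rw [Matrix.det_transpose] at h
  ext k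
  have hk := congrFun h k
  simp only [Matrix.mulVec, dotProduct, Matrix.cramer_transpose_apply, Pi.smul_apply,
    smul_eq_mul, Matrix.transpose_apply, Matrix.of_apply] at hk
  simp only [PiLp.smul_apply, smul_eq_mul, WithLp.ofLp_sum, Finset.sum_apply, WithLp.ofLp_smul,
    Pi.smul_apply]
  unfold rowDet
  rw [← hk]
  refine Finset.sum_congr rfl fun j _ => ?_
  rw [mul_comm]
  congr 2
  ext a b
  by_cases hab : a = j
  · subst hab; simp
  · simp [Matrix.updateRow_ne hab, Function.update_of_ne hab]

/-- The determinant of the rows as a continuous multilinear map. -/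
def rowDetMultilinear (m : ℕ) :
    ContinuousMultilinearMap ℝ (fun _ : Fin m => EuclideanSpace ℝ (Fin m)) ℝ where
  toMultilinearMap := (Matrix.detRowAlternating (R := ℝ) (n := Fin m)).toMultilinearMap.compLinearMap
    fun _ => (WithLp.linearEquiv 2 ℝ (Fin m → ℝ)).toLinearMap
  cont := by
    change Continuous fun v : Fin m → EuclideanSpace ℝ (Fin m) =>
      (Matrix.of fun i j => v i j).det
    refine Continuous.matrix_det ?_
    exact continuous_matrix fun i j => by
      change Continuous fun v : Fin m → EuclideanSpace ℝ (Fin m) => v i j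
      fun_prop

theorem rowDetMultilinear_apply {m : ℕ} (v : Fin m → EuclideanSpace ℝ (Fin m)) :
    rowDetMultilinear m v = rowDet v := rfl

theorem hasFDerivAt_rowDet {m : ℕ} (v : Fin m → EuclideanSpace ℝ (Fin m)) :
    ∃ L : (Fin m → EuclideanSpace ℝ (Fin m)) →L[ℝ] ℝ, HasFDerivAt rowDet L v ∧
      ∀ w, L w = ∑ i, rowDet (Function.update v i (w i)) :=
  ⟨_, (rowDetMultilinear m).hasFDerivAt v, fun w => by
    simp [ContinuousMultilinearMap.linearDeriv_apply, rowDetMultilinear_apply]⟩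

/-- First variation of the oriented Gaussian volume of a simplicial cone: only the flux through
the facets counts. -/
theorem hasFDerivAt_rowDet_mul_coneIntegral {n : ℕ}
    {v : Fin (n + 1) → EuclideanSpace ℝ (Fin (n + 1))} (hv : LinearIndependent ℝ v) :
    ∃ L : (Fin (n + 1) → EuclideanSpace ℝ (Fin (n + 1))) →L[ℝ] ℝ,
      HasFDerivAt (fun v => rowDet v * coneIntegral v) L v ∧
      ∀ w, L w = -∑ j, ∑ k, rowDet (Function.update v j (w (j.succAbove k))) *
        coneMoment (fun i => v (j.succAbove i)) k := by
  obtain ⟨L₁, h₁, hL₁⟩ := hasFDerivAt_rowDet v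
  obtain ⟨L₂, h₂, hL₂⟩ := hasFDerivAt_coneIntegral hv
  refine ⟨_, h₁.mul h₂, fun w => ?_⟩
  -- Cramer's rule writes the velocity `w i` in the basis `v`, so that integration by parts applies
  -- in each direction `v j`.
  have key : ∀ i, rowDet v * ∫ r, r i * ⟪∑ k, r k • v k, w i⟫ * gaussWeight v r
        ∂orthantMeasure (n + 1)
      = ∑ j, rowDet (Function.update v j (w i)) *
        ∫ r, r i * ⟪∑ k, r k • v k, v j⟫ * gaussWeight v r ∂orthantMeasure (n + 1) := fun i => by
    simp_rw [← integral_const_mul]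
    rw [← integral_finsetSum]
    · congr 1; ext r
      have : rowDet v * ⟪∑ k, r k • v k, w i⟫
          = ∑ j, rowDet (Function.update v j (w i)) * ⟪∑ k, r k • v k, v j⟫ := by
        rw [← real_inner_smul_right, rowDet_smul_eq_sum, inner_sum]
        simp_rw [real_inner_smul_right]
      calc _ = rowDet v * ⟪∑ k, r k • v k, w i⟫ * (r i * gaussWeight v r) := by ring
        _ = _ := by
          rw [this, Finset.sum_mul]
          exact Finset.sum_congr rfl fun j _ => by ring
    · exact fun j _ => ((hasGaussianDecay_coord_mul_inner hv i (v j)).integrable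
        (continuous_coord_mul_inner v i _)).const_mul _
  simp only [add_apply, smul_apply, smul_eq_mul, hL₁, hL₂]
  rw [mul_neg, Finset.mul_sum, Finset.sum_congr rfl fun i _ => key i, Finset.sum_comm]
  -- The diagonal terms `i = j` reproduce `coneIntegral v` and cancel the variation of the
  -- determinant; the others are facet moments.
  have key2 : ∀ j, ∑ i, rowDet (Function.update v j (w i)) *
        ∫ r, r i * ⟪∑ k, r k • v k, v j⟫ * gaussWeight v r ∂orthantMeasure (n + 1)
      = rowDet (Function.update v j (w j)) * coneIntegral v +
        ∑ k, rowDet (Function.update v j (w (j.succAbove k))) *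
          coneMoment (fun i => v (j.succAbove i)) k := fun j => by
    rw [Fin.sum_univ_succAbove _ j, integral_coord_mul_inner_self hv]
    simp_rw [integral_coord_mul_inner_succAbove hv]
  rw [Finset.sum_congr rfl fun j _ => key2 j, Finset.sum_add_distrib, ← Finset.sum_mul]
  ring

/-! ### Spherical volume as a Gaussian integral. -/

theorem integral_comp_linear_coordinates {m : ℕ} {v : Fin m → EuclideanSpace ℝ (Fin m)}
    (hv : rowDet v ≠ 0) (f : EuclideanSpace ℝ (Fin m) → ℝ) :
    ∫ x, f x = |rowDet v| * ∫ r : Fin m → ℝ, f (∑ i, r i • v i) := by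
  set M : Matrix (Fin m) (Fin m) ℝ := (Matrix.of fun i j => v i j).transpose
  have hM : M.det = rowDet v := Matrix.det_transpose _
  have hM0 : M.det ≠ 0 := by rwa [hM]
  have h1 : ∫ x, f x = ∫ y : Fin m → ℝ, f (WithLp.toLp 2 y) :=
    ((PiLp.volume_preserving_toLp (Fin m)).integral_comp
      (MeasurableEquiv.toLp 2 (Fin m → ℝ)).measurableEmbedding f).symm
  have hemb : MeasurableEmbedding (Matrix.toLin' M) := by
    have hinj : LinearMap.ker (Matrix.toLin' M) = ⊥ := by
      rw [Matrix.ker_toLin'_eq_bot_iff]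
      intro y hy
      exact Matrix.eq_zero_of_mulVec_eq_zero hM0 hy
    exact ((Matrix.toLin' M).isClosedEmbedding_of_injective hinj).measurableEmbedding
  have h2 := Real.map_matrix_volume_pi_eq_smul_volume_pi hM0
  have h3 : ∫ r : Fin m → ℝ, f (WithLp.toLp 2 (Matrix.toLin' M r))
      = |rowDet v|⁻¹ * ∫ y : Fin m → ℝ, f (WithLp.toLp 2 y) := by
    rw [← hemb.integral_map (fun y => f (WithLp.toLp 2 y)), h2, integral_smul_measure,
      ENNReal.toReal_ofReal (abs_nonneg _), abs_inv, hM, smul_eq_mul]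
  have h4 : ∀ r : Fin m → ℝ, WithLp.toLp 2 (Matrix.toLin' M r) = ∑ i, r i • v i := fun r => by
    ext k
    simp [M, Matrix.mulVec, dotProduct, mul_comm]
  simp_rw [h4] at h3
  rw [h1, h3, ← mul_assoc, mul_inv_cancel₀ (abs_ne_zero.2 hv), one_mul]

/-- The ratio between the Gaussian volume of a cone in `ℝ⁴` and the spherical volume of its
trace on the unit sphere. -/
def radialIntegral : ℝ :=
  ∫ s : Set.Ioi (0 : ℝ), Real.exp (-((s : ℝ) ^ 2 / 2)) ∂Measure.volumeIoiPow 3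

/-- Polar coordinates: the weight depends on the radius alone, the indicator on the direction alone,
so the integral factors. -/
theorem integral_gaussian_radial_set (A : Set S3) (hA : MeasurableSet A) :
    ∫ x : ({0}ᶜ : Set E4), A.indicator 1 (homeomorphUnitSphereProd E4 x).1 *
        Real.exp (-(‖(x : E4)‖ ^ 2 / 2)) ∂((volume : Measure E4).comap Subtype.val)
      = sphereVolume.real A * radialIntegral := by
  have hmp := (volume : Measure E4).measurePreserving_homeomorphUnitSphereProd
  have hd : Module.finrank ℝ E4 - 1 = 3 := by simp
  rw [hd] at hmp
  have h := hmp.integral_comp (Homeomorph.measurableEmbedding _)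
    (fun p : S3 × Set.Ioi (0 : ℝ) => A.indicator (1 : S3 → ℝ) p.1 *
      Real.exp (-((p.2 : ℝ) ^ 2 / 2)))
  rw [integral_prod_mul (A.indicator (1 : S3 → ℝ))
    (fun s : Set.Ioi (0 : ℝ) => Real.exp (-((s : ℝ) ^ 2 / 2)))] at h
  rw [integral_indicator_one hA] at h
  simpa [radialIntegral, sphereVolume] using h

/-- For the whole sphere the factorization gives the Gaussian integral over four-space, which is
positive. -/
theorem radialIntegral_ne_zero : radialIntegral ≠ 0 := by
  intro h0
  have h := integral_gaussian_radial_set Set.univ MeasurableSet.univ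
  simp only [h0, mul_zero, Set.indicator_univ, Pi.one_apply, one_mul] at h
  rw [integral_subtype_comap (measurableSet_singleton _).compl
    (fun x : E4 => Real.exp (-(‖x‖ ^ 2 / 2))), restrict_compl_singleton] at h
  have h2 := GaussianFourier.integral_rexp_neg_mul_sq_norm (V := E4) (b := 1 / 2) (by norm_num)
  have h3 : (fun x : E4 => Real.exp (-(1 / 2) * ‖x‖ ^ 2)) = fun x => Real.exp (-(‖x‖ ^ 2 / 2)) := by
    ext x; congr 1; ring
  rw [h3, h] at h2
  have : 0 < (Real.pi / (1 / 2)) ^ ((Module.finrank ℝ E4 : ℝ) / 2) := by positivity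
  linarith

theorem mem_sphericalHull_range {n : ℕ} {v : Fin n → S3} {y : S3} :
    y ∈ sphericalHull (Set.range v) ↔
      ∃ r : Fin n → ℝ, (∀ i, 0 ≤ r i) ∧ (y : E4) = ∑ i, r i • (v i : E4) := by
  unfold sphericalHull
  rw [Set.mem_ofPred_eq, ← Set.range_comp, Submodule.mem_span_range_iff_exists_fun]
  constructor
  · rintro ⟨c, hc⟩
    exact ⟨fun i => c i, fun i => (c i).2, hc.symm⟩
  · rintro ⟨r, hr, h⟩
    exact ⟨fun i => ⟨r i, hr i⟩, h.symm⟩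

theorem LinearIndependent.eq_of_sum_smul_eq {E : Type*} [AddCommGroup E] [Module ℝ E] {n : ℕ}
    {v : Fin n → E} (hv : LinearIndependent ℝ v) {r s : Fin n → ℝ}
    (h : ∑ i, r i • v i = ∑ i, s i • v i) : r = s :=
  linearIndependent_iff_injective_fintypeLinearCombination.1 hv
    (by simpa [Fintype.linearCombination_apply] using h)

theorem isClosed_sphericalHull_range {n : ℕ} {v : Fin n → S3}
    (hv : LinearIndependent ℝ fun i => (v i : E4)) : IsClosed (sphericalHull (Set.range v)) := by
  have h1 : IsClosed ((Fintype.linearCombination ℝ fun i => (v i : E4)) '' Set.Ici 0) :=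
    (LinearMap.isClosedEmbedding_of_injective (LinearMap.ker_eq_bot.2
      (linearIndependent_iff_injective_fintypeLinearCombination.1 hv))).isClosedMap _ isClosed_Ici
  have h2 : sphericalHull (Set.range v)
      = (↑) ⁻¹' ((Fintype.linearCombination ℝ fun i => (v i : E4)) '' Set.Ici 0) := by
    ext y
    rw [mem_sphericalHull_range]
    constructor
    · rintro ⟨r, hr, h⟩
      exact ⟨r, hr, by rw [h, Fintype.linearCombination_apply]⟩
    · rintro ⟨r, hr, h⟩
      exact ⟨r, hr, by rw [← h, Fintype.linearCombination_apply]⟩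
  rw [h2]
  exact h1.preimage continuous_subtype_val

/-- The volume of a spherical tetrahedron as a Gaussian integral. -/
theorem sphereVolume_sphericalHull {v : Fin 4 → S3} (hv : rowDet (fun i => (v i : E4)) ≠ 0) :
    sphereVolume.real (sphericalHull (Set.range v)) * radialIntegral =
      |rowDet fun i => (v i : E4)| * coneIntegral fun i => (v i : E4) := by
  have hli := linearIndependent_iff_rowDet_ne_zero.2 hv
  set H := sphericalHull (Set.range v)
  rw [← integral_gaussian_radial_set H (isClosed_sphericalHull_range hli).measurableSet]
  set C : Set E4 := (Fintype.linearCombination ℝ fun i => (v i : E4)) '' Set.Ici 0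
  have h1 : ∀ x : ({0}ᶜ : Set E4), H.indicator (1 : S3 → ℝ) (homeomorphUnitSphereProd E4 x).1 *
        Real.exp (-(‖(x : E4)‖ ^ 2 / 2))
      = (fun x : E4 => C.indicator (1 : E4 → ℝ) x * Real.exp (-(‖x‖ ^ 2 / 2))) x := fun x => by
    have hx : (0 : ℝ) < ‖(x : E4)‖ := norm_pos_iff.2 x.2
    have : (homeomorphUnitSphereProd E4 x).1 ∈ H ↔ (x : E4) ∈ C := by
      rw [mem_sphericalHull_range]
      have hval : (((homeomorphUnitSphereProd E4 x).1 : S3) : E4) = ‖(x : E4)‖⁻¹ • (x : E4) := by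
        simp
      constructor
      · rintro ⟨r, hr, h⟩
        refine ⟨‖(x : E4)‖ • r, smul_nonneg hx.le (show 0 ≤ r from hr), ?_⟩
        rw [map_smul, Fintype.linearCombination_apply, ← h, hval, smul_inv_smul₀ hx.ne']
      · rintro ⟨r, hr, h⟩
        refine ⟨‖(x : E4)‖⁻¹ • r, smul_nonneg (inv_nonneg.2 hx.le) (show 0 ≤ r from hr), ?_⟩
        rw [hval, ← h, Fintype.linearCombination_apply, Finset.smul_sum]
        simp [smul_smul]
    by_cases h : (x : E4) ∈ C
    · simp [Set.indicator_of_mem h, Set.indicator_of_mem (this.2 h)]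
    · simp [Set.indicator_of_notMem h, Set.indicator_of_notMem (mt this.1 h)]
  simp_rw [h1]
  rw [integral_subtype_comap (measurableSet_singleton _).compl
      (fun x : E4 => C.indicator (1 : E4 → ℝ) x * Real.exp (-(‖x‖ ^ 2 / 2))),
    restrict_compl_singleton, integral_comp_linear_coordinates hv]
  congr 1
  have h2 : orthantMeasure 4 = (volume : Measure (Fin 4 → ℝ)).restrict (Set.Ici 0) := by
    unfold orthantMeasure
    rw [← Measure.restrict_pi_pi, Set.pi_univ_Ici]
    rfl
  unfold coneIntegral
  rw [h2, ← integral_indicator measurableSet_Ici]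
  congr 1; ext r
  have h3 : ∑ i, r i • (v i : E4) ∈ C ↔ r ∈ Set.Ici 0 := by
    constructor
    · rintro ⟨s, hs, h⟩
      rw [Fintype.linearCombination_apply] at h
      rwa [← hli.eq_of_sum_smul_eq h]
    · exact fun h => ⟨r, h, Fintype.linearCombination_apply _ _ _⟩
  by_cases hr : r ∈ Set.Ici 0
  · rw [Set.indicator_of_mem hr, Set.indicator_of_mem (h3.2 hr), Pi.one_apply, one_mul]
    rfl
  · rw [Set.indicator_of_notMem hr, Set.indicator_of_notMem (fun h => hr (h3.1 h)), zero_mul]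

theorem sphereVolume_univ : sphereVolume.real Set.univ = 2 * Real.pi ^ 2 := by
  unfold sphereVolume
  rw [Measure.toSphere_real_apply_univ, Measure.real, EuclideanSpace.volume_ball]
  have h1 : Real.Gamma ((Fintype.card (Fin 4) : ℝ) / 2 + 1) = 2 := by
    have : ((Fintype.card (Fin 4) : ℝ) / 2 + 1) = (2 : ℕ) + 1 := by norm_num
    rw [this, Real.Gamma_nat_eq_factorial]; norm_num
  have h2 : √Real.pi ^ 4 = Real.pi ^ 2 := by
    rw [show 4 = 2 * 2 from rfl, pow_mul, Real.sq_sqrt Real.pi_pos.le]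
  rw [h1]
  simp only [Fintype.card_fin, h2]
  rw [ENNReal.toReal_mul, ENNReal.toReal_ofReal (by positivity)]
  simp
  ring

/-! ### The boundary of a generic spherical 4-simplex. -/

instance : IsFiniteMeasure sphereVolume := by unfold sphereVolume; infer_instance

instance : sphereVolume.IsOpenPosMeasure := by unfold sphereVolume; infer_instance

instance : NeZero sphereVolume := ⟨by unfold sphereVolume; exact Measure.toSphere_ne_zero _⟩

/-- Almost no point of the sphere lies in a given proper subspace. -/
theorem ae_notMem_of_ne_top {W : Submodule ℝ E4} (hW : W ≠ ⊤) :
    ∀ᵐ z : S3 ∂sphereVolume, (z : E4) ∉ W := by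
  rw [ae_iff]
  have hm : MeasurableSet {z : S3 | ¬ (z : E4) ∉ W} := by
    simp only [not_not]
    exact (W.closed_of_finiteDimensional.preimage continuous_subtype_val).measurableSet
  unfold sphereVolume
  rw [Measure.toSphere_apply' _ hm]
  refine mul_eq_zero_of_right _ (measure_mono_null ?_ (Measure.addHaar_submodule volume W hW))
  rintro _ ⟨s, _, _, ⟨z, hz, rfl⟩, rfl⟩
  exact W.smul_mem s (not_not.1 hz)

theorem span_finset_image_ne_top {ι : Type*} (v : ι → E4) (s : Finset ι) (hs : s.card < 4) :
    Submodule.span ℝ (v '' s) ≠ ⊤ := by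
  intro h
  classical
  have h1 : Module.finrank ℝ (Submodule.span ℝ (v '' s)) ≤ s.card := by
    rw [← Finset.coe_image]
    exact (finrank_span_finset_le_card _).trans Finset.card_image_le
  rw [h, finrank_top] at h1
  simp at h1
  omega

/-- The volume of a spherical tetrahedron with the sign of its orientation. -/
def orientedTetra (u : Fin 4 → S3) : ℝ :=
  SignType.sign (rowDet fun i => (u i : E4)) * sphereVolume.real (sphericalHull (Set.range u))

/-- The conditions `0 ≤ l j * (s - t j)` cut out an interval of `s`, bounded from below by the `t j`
with `l j > 0` and from above by those with `l j < 0`. The sum counts its endpoints, left ones as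
`1` and right ones as `-1`. If both signs occur, the interval is empty or has one endpoint of each
kind; otherwise it is a half-line. So the result depends only on the signs of `l`. -/
theorem sum_sign_extremal {ι : Type*} [Fintype ι] [Nonempty ι] {l : ι → ℝ}
    (hl : ∀ i, l i ≠ 0) : ∃ k : ℤ, ∀ t : ι → ℝ, Function.Injective t →
      ∑ i, (SignType.sign (l i) : ℝ) * Set.indicator {i | ∀ j, 0 ≤ l j * (t i - t j)} 1 i = k := by
  classical
  have hP : ∀ t : ι → ℝ, ∀ i, i ∈ {i | ∀ j, 0 ≤ l j * (t i - t j)} ↔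
      ∀ j, (0 < l j → t j ≤ t i) ∧ (l j < 0 → t i ≤ t j) := fun t i => by
    refine forall_congr' fun j => ?_
    rcases lt_or_gt_of_ne (hl j) with h | h
    · have : 0 ≤ l j * (t i - t j) ↔ t i ≤ t j := by
        rw [← neg_mul_neg, mul_nonneg_iff_of_pos_left (neg_pos.2 h)]; simp
      simp [this, h, not_lt.2 h.le]
    · simp [mul_nonneg_iff_of_pos_left h, h, not_lt.2 h.le]
  by_cases hpos : ∃ i, 0 < l i <;> by_cases hneg : ∃ i, l i < 0
  · refine ⟨0, fun t ht => ?_⟩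
    obtain ⟨p, hp, hpm⟩ := Set.exists_max_image {i | 0 < l i} t (Set.toFinite _) hpos
    obtain ⟨m, hm, hmm⟩ := Set.exists_min_image {i | l i < 0} t (Set.toFinite _) hneg
    have hpm' : p ≠ m := by
      rintro rfl
      exact lt_asymm (show 0 < l p from hp) (show l p < 0 from hm)
    by_cases hc : t p ≤ t m
    · have hset : {i | ∀ j, 0 ≤ l j * (t i - t j)} = {p, m} := by
        ext i
        rw [hP]
        constructor
        · intro h
          rcases lt_or_gt_of_ne (hl i) with hi | hi
          · exact Or.inr (ht (le_antisymm ((h m).2 hm) (hmm i hi)))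
          · exact Or.inl (ht (le_antisymm (hpm i hi) ((h p).1 hp)))
        · rintro (rfl | rfl) j
          · exact ⟨fun hj => hpm j hj, fun hj => hc.trans (hmm j hj)⟩
          · exact ⟨fun hj => (hpm j hj).trans hc, fun hj => hmm j hj⟩
      rw [hset, ← Finset.sum_subset (Finset.subset_univ {p, m}), Finset.sum_pair hpm']
      · have h1 : SignType.sign (l p) = 1 := sign_pos hp
        have h2 : SignType.sign (l m) = -1 := sign_neg hm
        simp [h1, h2]
      · intro i _ hi
        rw [Set.indicator_of_notMem (by simpa using hi), mul_zero]
    · have hset : {i | ∀ j, 0 ≤ l j * (t i - t j)} = ∅ := by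
        ext i
        rw [hP]
        refine iff_of_false (fun h => hc ?_) (Set.notMem_empty i)
        exact ((h p).1 hp).trans ((h m).2 hm)
      simp [hset]
  · refine ⟨1, fun t ht => ?_⟩
    have hall : ∀ i, 0 < l i := fun i => (lt_or_gt_of_ne (hl i)).resolve_left fun h => hneg ⟨i, h⟩
    obtain ⟨p, -, hpm⟩ := Set.exists_max_image Set.univ t (Set.toFinite _) Set.univ_nonempty
    have hset : {i | ∀ j, 0 ≤ l j * (t i - t j)} = {p} := by
      ext i
      rw [hP]
      constructor
      · exact fun h => ht (le_antisymm (hpm i trivial) ((h p).1 (hall p)))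
      · rintro rfl j
        exact ⟨fun _ => hpm j trivial, fun h => absurd h (not_lt.2 (hall j).le)⟩
    rw [hset, Finset.sum_eq_single p]
    · simp [sign_pos (hall p)]
    · intro i _ hi
      rw [Set.indicator_of_notMem (by simpa using hi), mul_zero]
    · simp
  · refine ⟨-1, fun t ht => ?_⟩
    have hall : ∀ i, l i < 0 := fun i => (lt_or_gt_of_ne (hl i)).resolve_right fun h => hpos ⟨i, h⟩
    obtain ⟨p, -, hpm⟩ := Set.exists_min_image Set.univ t (Set.toFinite _) Set.univ_nonempty
    have hset : {i | ∀ j, 0 ≤ l j * (t i - t j)} = {p} := by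
      ext i
      rw [hP]
      constructor
      · exact fun h => ht (le_antisymm ((h p).2 (hall p)) (hpm i trivial))
      · rintro rfl j
        exact ⟨fun h => absurd h (not_lt.2 (hall j).le), fun _ => hpm j trivial⟩
    rw [hset, Finset.sum_eq_single p]
    · simp [sign_neg (hall p)]
    · intro i _ hi
      rw [Set.indicator_of_notMem (by simpa using hi), mul_zero]
    · simp
  · obtain ⟨i⟩ := ‹Nonempty ι›
    rcases lt_or_gt_of_ne (hl i) with h | h
    exacts [absurd ⟨i, h⟩ hneg, absurd ⟨i, h⟩ hpos]

/-- The linear relation between `m + 1` vectors of `ℝᵐ`. -/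
theorem sum_alternating_rowDet_smul {m : ℕ} (v : Fin (m + 1) → EuclideanSpace ℝ (Fin m)) :
    ∑ i : Fin (m + 1), ((-1) ^ (i : ℕ) * rowDet fun k => v (i.succAbove k)) • v i = 0 := by
  ext j
  -- The `j`-th coordinate column is repeated in front; Laplace expansion along it is the `j`-th
  -- coordinate of the relation.
  let A : Matrix (Fin (m + 1)) (Fin (m + 1)) ℝ :=
    Matrix.of fun i k => Fin.cons (α := fun _ => ℝ) (v i j) (fun k => v i k) k
  have h0 : A.det = 0 := by
    refine Matrix.det_zero_of_column_eq (Fin.succ_ne_zero j).symm fun i => ?_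
    simp [A]
  rw [Matrix.det_succ_column_zero] at h0
  simp only [WithLp.ofLp_sum, WithLp.ofLp_smul, Finset.sum_apply, Pi.smul_apply, smul_eq_mul]
  refine Eq.trans (Finset.sum_congr rfl fun i _ => ?_) h0
  have : A.submatrix i.succAbove Fin.succ = Matrix.of fun k l => v (i.succAbove k) l := by
    ext k l; simp [A]
  rw [this]
  simp only [A, rowDet, Matrix.of_apply, Fin.cons_zero]
  ring

/-- The oriented volumes of the facets of a generic spherical 4-simplex add up to a multiple of
the volume of the sphere. -/
theorem exists_sum_alternating_orientedTetra {v : Fin 5 → S3}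
    (hv : ∀ i : Fin 5, rowDet (fun k => (v (i.succAbove k) : E4)) ≠ 0) :
    ∃ k : ℤ, ∑ i : Fin 5, (-1) ^ (i : ℕ) * orientedTetra (fun k => v (i.succAbove k))
      = k * (2 * Real.pi ^ 2) := by
  set l : Fin 5 → ℝ := fun i => (-1) ^ (i : ℕ) * rowDet fun k => (v (i.succAbove k) : E4)
  have hl : ∀ i, l i ≠ 0 := fun i => mul_ne_zero (pow_ne_zero _ (by norm_num)) (hv i)
  have hrel : ∑ i, l i • (v i : E4) = 0 := sum_alternating_rowDet_smul fun i => (v i : E4)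
  have hli := fun i => linearIndependent_iff_rowDet_ne_zero.2 (hv i)
  obtain ⟨k, hk⟩ := sum_sign_extremal hl
  refine ⟨k, ?_⟩
  set H : Fin 5 → Set S3 := fun i => sphericalHull (Set.range fun k => v (i.succAbove k))
  have hH : ∀ i, MeasurableSet (H i) := fun i =>
    (isClosed_sphericalHull_range (v := fun k => v (i.succAbove k)) (hli i)).measurableSet
  have hsum : ∑ i : Fin 5, (-1) ^ (i : ℕ) * orientedTetra (fun k => v (i.succAbove k))
      = ∑ i, (SignType.sign (l i) : ℝ) * sphereVolume.real (H i) := by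
    refine Finset.sum_congr rfl fun i _ => ?_
    simp only [orientedTetra, l, sign_mul, H, ← mul_assoc]
    congr 1
    push_cast
    congr 1
    rcases neg_one_pow_eq_or ℝ (i : ℕ) with h | h <;> rw [h] <;> simp [sign_neg]
  have hint : ∑ i, (SignType.sign (l i) : ℝ) * sphereVolume.real (H i)
      = ∫ z, ∑ i, (SignType.sign (l i) : ℝ) * (H i).indicator 1 z ∂sphereVolume := by
    rw [integral_finsetSum]
    · refine Finset.sum_congr rfl fun i _ => ?_
      rw [integral_const_mul, integral_indicator_one (hH i)]
    · exact fun i _ => ((integrable_const (1 : ℝ)).indicator (hH i)).const_mul _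
  -- A generic `z` lies in the span of no three of the five vectors; this makes the parameters `t i`
  -- below distinct.
  have hgen : ∀ᵐ z : S3 ∂sphereVolume, ∀ i j : Fin 5, i ≠ j →
      (z : E4) ∉ Submodule.span ℝ ((fun i => (v i : E4)) '' ({i, j}ᶜ : Finset (Fin 5))) := by
    rw [ae_all_iff]; intro i
    rw [ae_all_iff]; intro j
    by_cases hij : i = j
    · simp [hij]
    · filter_upwards [ae_notMem_of_ne_top (span_finset_image_ne_top (fun i => (v i : E4))
        ({i, j}ᶜ : Finset (Fin 5)) (by
          rw [Finset.card_compl, Finset.card_pair hij]; decide))] with z hz _ using hz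
  have hae : ∀ᵐ z ∂sphereVolume, ∑ i, (SignType.sign (l i) : ℝ) * (H i).indicator 1 z = k := by
    filter_upwards [hgen] with z hz
    obtain ⟨μ, hμ⟩ : ∃ μ : Fin 5 → ℝ, ∑ i, μ i • (v i : E4) = z := by
      have h := rowDet_smul_eq_sum (fun k => (v ((0 : Fin 5).succAbove k) : E4)) (z : E4)
      refine ⟨Fin.cons 0 fun j => (rowDet fun k => (v ((0 : Fin 5).succAbove k) : E4))⁻¹ *
        rowDet (Function.update (fun k => (v ((0 : Fin 5).succAbove k) : E4)) j z), ?_⟩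
      rw [Fin.sum_univ_succ]
      simp only [Fin.cons_zero, zero_smul, Fin.cons_succ, zero_add, mul_smul]
      rw [← Finset.smul_sum]
      exact (congrArg _ h.symm).trans (inv_smul_smul₀ (hv 0) _)
    -- All representations of `z` form the line `μ + s • l`, and its `i`-th coordinate `l i * (s - t
    -- i)` vanishes at `s = t i`. So `z` lies in the facet `H i` if and only if all coordinates are
    -- nonnegative at `s = t i`.
    set t : Fin 5 → ℝ := fun i => -(μ i / l i)
    have hμt : ∀ i, μ i = -(t i * l i) := fun i => by
      simp only [t]; field_simp [hl i]
    have hz2 : ∀ s : ℝ, ∑ i, (l i * (s - t i)) • (v i : E4) = z := fun s => by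
      have : ∀ i, (l i * (s - t i)) • (v i : E4) = s • l i • (v i : E4) + μ i • (v i : E4) :=
        fun i => by rw [hμt]; module
      simp_rw [this]
      rw [Finset.sum_add_distrib, ← Finset.smul_sum, hrel, smul_zero, zero_add, hμ]
    have ht : Function.Injective t := by
      intro i j hij
      by_contra hne
      refine hz i j hne ?_
      rw [← hz2 (t i)]
      refine Submodule.sum_mem _ fun a _ => ?_
      by_cases ha : a = i ∨ a = j
      · rcases ha with rfl | rfl <;> simp [hij]
      · exact Submodule.smul_mem _ _ (Submodule.subset_span ⟨a, by simpa [and_comm] using ha, rfl⟩)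
    rw [← hk t ht]
    refine Finset.sum_congr rfl fun i _ => ?_
    congr 1
    have hiff : z ∈ H i ↔ i ∈ {i | ∀ j, 0 ≤ l j * (t i - t j)} := by
      have hzi := hz2 (t i)
      rw [Fin.sum_univ_succAbove _ i, sub_self, mul_zero, zero_smul, zero_add] at hzi
      rw [mem_sphericalHull_range]
      constructor
      · rintro ⟨r, hr, h⟩ j
        have := (hli i).eq_of_sum_smul_eq (hzi.trans h)
        rcases Fin.eq_self_or_eq_succAbove i j with rfl | ⟨a, rfl⟩
        · simp
        · exact (hr a).trans_eq (congrFun this a).symm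
      · exact fun h => ⟨_, fun a => h (i.succAbove a), hzi.symm⟩
    by_cases h : z ∈ H i
    · rw [Set.indicator_of_mem h, Set.indicator_of_mem (hiff.1 h)]; rfl
    · rw [Set.indicator_of_notMem h, Set.indicator_of_notMem (mt hiff.2 h)]
  rw [hsum, hint, integral_congr_ae hae, integral_const, sphereVolume_univ, smul_eq_mul, mul_comm]

theorem rowDet_comp_perm {m : ℕ} (v : Fin m → EuclideanSpace ℝ (Fin m)) (e : Equiv.Perm (Fin m)) :
    rowDet (v ∘ e) = (Equiv.Perm.sign e : ℤ) * rowDet v :=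
  Matrix.det_permute e (Matrix.of fun i j => v i j)

theorem rowDet_swap₀₁ (a b c d : E4) : rowDet ![b, a, c, d] = -rowDet ![a, b, c, d] := by
  have h := rowDet_comp_perm ![a, b, c, d] (Equiv.swap 0 1)
  rw [Equiv.Perm.sign_swap (by decide)] at h
  have e : ![a, b, c, d] ∘ Equiv.swap (0 : Fin 4) 1 = ![b, a, c, d] := by
    ext i : 1; fin_cases i <;> rfl
  rw [e] at h
  simpa using h

theorem rowDet_swap₁₂ (a b c d : E4) : rowDet ![a, c, b, d] = -rowDet ![a, b, c, d] := by
  have h := rowDet_comp_perm ![a, b, c, d] (Equiv.swap 1 2)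
  rw [Equiv.Perm.sign_swap (by decide)] at h
  have e : ![a, b, c, d] ∘ Equiv.swap (1 : Fin 4) 2 = ![a, c, b, d] := by
    ext i : 1; fin_cases i <;> rfl
  rw [e] at h
  simpa using h

theorem rowDet_swap₂₃ (a b c d : E4) : rowDet ![a, b, d, c] = -rowDet ![a, b, c, d] := by
  have h := rowDet_comp_perm ![a, b, c, d] (Equiv.swap 2 3)
  rw [Equiv.Perm.sign_swap (by decide)] at h
  have e : ![a, b, c, d] ∘ Equiv.swap (2 : Fin 4) 3 = ![a, b, d, c] := by
    ext i : 1; fin_cases i <;> rfl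
  rw [e] at h
  simpa using h

theorem coe_vecFour (a b c d : S3) :
    (fun i => ((![a, b, c, d] : Fin 4 → S3) i : E4)) = ![(a : E4), b, c, d] := by
  ext i : 1; fin_cases i <;> rfl

theorem det4_eq_rowDet (a b c d : S3) : det4 a b c d = rowDet ![(a : E4), b, c, d] := by
  rw [← coe_vecFour]; rfl

theorem det4_ne_zero_iff {a b c d : S3} :
    det4 a b c d ≠ 0 ↔ LinearIndependent ℝ ![(a : E4), b, c, d] := by
  rw [det4_eq_rowDet, linearIndependent_iff_rowDet_ne_zero]

theorem orientedTetra_vecFour (a b c d : S3) : orientedTetra ![a, b, c, d] =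
    SignType.sign (det4 a b c d) * sphereVolume.real (sphericalHull {a, b, c, d}) := by
  unfold orientedTetra
  rw [coe_vecFour, ← det4_eq_rowDet]
  congr 3
  simp only [Matrix.range_cons, Matrix.range_empty, Set.union_empty, Set.singleton_union]

theorem orientedTetra_swap₀₁ (a b c d : S3) :
    orientedTetra ![b, a, c, d] = -orientedTetra ![a, b, c, d] := by
  rw [orientedTetra_vecFour, orientedTetra_vecFour, Set.insert_comm b a, det4_eq_rowDet,
    det4_eq_rowDet, rowDet_swap₀₁, Left.sign_neg]
  simp

theorem orientedTetra_swap₁₂ (a b c d : S3) :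
    orientedTetra ![a, c, b, d] = -orientedTetra ![a, b, c, d] := by
  rw [orientedTetra_vecFour, orientedTetra_vecFour, Set.insert_comm c b, det4_eq_rowDet,
    det4_eq_rowDet, rowDet_swap₁₂, Left.sign_neg]
  simp

theorem orientedTetra_swap₂₃ (a b c d : S3) :
    orientedTetra ![a, b, d, c] = -orientedTetra ![a, b, c, d] := by
  rw [orientedTetra_vecFour, orientedTetra_vecFour, Set.pair_comm d c, det4_eq_rowDet,
    det4_eq_rowDet, rowDet_swap₂₃, Left.sign_neg]
  simp

/-- The facet relation of the 4-simplex `p, r, a, b, c`, arranged for a change of apex from `r` to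
`p`: the three tetrahedra over the edges of `a, b, c` will cancel on a closed surface. -/
theorem exists_sum_orientedTetra {p r a b c : S3} (h₀ : det4 a b c r ≠ 0) (h₁ : det4 a b c p ≠ 0)
    (h₂ : det4 p r b c ≠ 0) (h₃ : det4 p r c a ≠ 0) (h₄ : det4 p r a b ≠ 0) :
    ∃ k : ℤ, orientedTetra ![a, b, c, p] - orientedTetra ![a, b, c, r]
      + (orientedTetra ![p, r, a, b] + orientedTetra ![p, r, b, c] + orientedTetra ![p, r, c, a])
      = k * (2 * Real.pi ^ 2) := by
  have e0 : (fun k => (![p, r, a, b, c] : Fin 5 → S3) ((0 : Fin 5).succAbove k)) = ![r, a, b, c] := by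
    ext i : 1; fin_cases i <;> rfl
  have e1 : (fun k => (![p, r, a, b, c] : Fin 5 → S3) ((1 : Fin 5).succAbove k)) = ![p, a, b, c] := by
    ext i : 1; fin_cases i <;> rfl
  have e2 : (fun k => (![p, r, a, b, c] : Fin 5 → S3) ((2 : Fin 5).succAbove k)) = ![p, r, b, c] := by
    ext i : 1; fin_cases i <;> rfl
  have e3 : (fun k => (![p, r, a, b, c] : Fin 5 → S3) ((3 : Fin 5).succAbove k)) = ![p, r, a, c] := by
    ext i : 1; fin_cases i <;> rfl
  have e4 : (fun k => (![p, r, a, b, c] : Fin 5 → S3) ((4 : Fin 5).succAbove k)) = ![p, r, a, b] := by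
    ext i : 1; fin_cases i <;> rfl
  have cyc : ∀ a b c d : E4, rowDet ![d, a, b, c] = -rowDet ![a, b, c, d] := fun a b c d => by
    rw [rowDet_swap₀₁, rowDet_swap₁₂, rowDet_swap₂₃]; ring
  have cycT : ∀ a b c d : S3, orientedTetra ![d, a, b, c] = -orientedTetra ![a, b, c, d] :=
    fun a b c d => by
    rw [orientedTetra_swap₀₁, orientedTetra_swap₁₂, orientedTetra_swap₂₃]; ring
  obtain ⟨k, hk⟩ := exists_sum_alternating_orientedTetra (v := ![p, r, a, b, c]) (by
    rw [det4_eq_rowDet] at h₀ h₁ h₂ h₃ h₄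
    have key : ∀ i : Fin 5, ∀ u : Fin 4 → S3,
        (fun k => (![p, r, a, b, c] : Fin 5 → S3) (i.succAbove k)) = u →
        rowDet (fun k => (u k : E4)) ≠ 0 →
        rowDet (fun k => ((![p, r, a, b, c] : Fin 5 → S3) (i.succAbove k) : E4)) ≠ 0 := by
      rintro i u rfl h; exact h
    intro i
    fin_cases i
    · refine key _ _ e0 ?_
      rw [coe_vecFour, cyc]; exact neg_ne_zero.2 h₀
    · refine key _ _ e1 ?_
      rw [coe_vecFour, cyc]; exact neg_ne_zero.2 h₁
    · refine key _ _ e2 ?_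
      rw [coe_vecFour]; exact h₂
    · refine key _ _ e3 ?_
      rw [coe_vecFour, rowDet_swap₂₃]; exact neg_ne_zero.2 h₃
    · refine key _ _ e4 ?_
      rw [coe_vecFour]; exact h₄)
  refine ⟨k, ?_⟩
  rw [Fin.sum_univ_five, e0, e1, e2, e3, e4, cycT a b c r, cycT a b c p,
    orientedTetra_swap₂₃ p r c a] at hk
  rw [← hk]
  simp
  ring

theorem linearIndependent_vecFour {a b c z : E4} (h : LinearIndependent ℝ ![a, b, c])
    (hz : z ∉ Submodule.span ℝ (Set.range ![a, b, c])) : LinearIndependent ℝ ![a, b, c, z] := by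
  have e : ![a, b, c, z] = Fin.snoc ![a, b, c] z := by
    ext i : 1; fin_cases i <;> rfl
  rw [e]
  exact linearIndependent_finSnoc.2 ⟨h, hz⟩

theorem ae_det4_ne_zero {a b c : S3} (h : LinearIndependent ℝ ![(a : E4), b, c]) :
    ∀ᵐ z ∂sphereVolume, det4 a b c z ≠ 0 := by
  have hW : Submodule.span ℝ (Set.range ![(a : E4), b, c]) ≠ ⊤ := by
    have := span_finset_image_ne_top ![(a : E4), b, c] Finset.univ (by simp)
    simpa using this
  filter_upwards [ae_notMem_of_ne_top hW] with z hz
  exact det4_ne_zero_iff.2 (linearIndependent_vecFour h hz)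

/-! ### Pairing of opposite edges and independence of the apex. -/

namespace OrientedTriangulation

variable {V F : Type*} (K : OrientedTriangulation V F)

/-- A directed edge determines its triangle and position, so a chosen opposite of an opposite is the
original: the choice is an involution. -/
theorem exists_opposite_equiv : ∃ e : F × Fin 3 ≃ F × Fin 3, ∀ h,
    K.vert (e h).1 (e h).2 = K.vert h.1 (h.2 + 1) ∧
    K.vert (e h).1 ((e h).2 + 1) = K.vert h.1 h.2 := by
  have H : ∀ h : F × Fin 3, ∃ k : F × Fin 3, K.vert k.1 k.2 = K.vert h.1 (h.2 + 1) ∧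
      K.vert k.1 (k.2 + 1) = K.vert h.1 h.2 := fun h => by
    obtain ⟨g, j, h1, h2⟩ := K.exists_opposite h.1 h.2
    exact ⟨(g, j), h1, h2⟩
  choose o ho using H
  refine ⟨⟨o, o, fun h => ?_, fun h => ?_⟩, ho⟩ <;>
  · refine K.edge_injective ?_
    simp only [Prod.mk.injEq]
    exact ⟨(ho (o h)).1.trans (ho h).2, (ho (o h)).2.trans (ho h).1⟩

/-- A function of the directed edges that changes its sign with the direction sums up to zero. -/
theorem sum_eq_zero_of_opposite [Fintype F] (φ : F → Fin 3 → ℝ)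
    (h : ∀ f i g j, K.vert g j = K.vert f (i + 1) → K.vert g (j + 1) = K.vert f i →
      φ f i + φ g j = 0) : ∑ f, ∑ i, φ f i = 0 := by
  obtain ⟨e, he⟩ := K.exists_opposite_equiv
  have h1 : ∑ h : F × Fin 3, φ h.1 h.2 = ∑ h : F × Fin 3, φ (e h).1 (e h).2 :=
    (e.sum_comp fun h => φ h.1 h.2).symm
  have h2 : ∑ h : F × Fin 3, (φ h.1 h.2 + φ (e h).1 (e h).2) = 0 :=
    Finset.sum_eq_zero fun p _ => h _ _ _ _ (he p).1 (he p).2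
  rw [Finset.sum_add_distrib, ← h1] at h2
  rw [← Fintype.sum_prod_type']
  linarith

theorem range_vert (x : V → S3) (f : F) : x '' Set.range (K.vert f) =
    {x (K.vert f 0), x (K.vert f 1), x (K.vert f 2)} := by
  have : K.vert f = ![K.vert f 0, K.vert f 1, K.vert f 2] := by
    ext i; fin_cases i <;> rfl
  rw [this]
  simp only [Matrix.range_cons, Matrix.range_empty, Set.union_empty, Set.singleton_union,
    Set.image_insert_eq, Set.image_singleton]
  rfl

theorem orientedVolume_eq [Fintype F] (x : V → S3) (q : S3) : K.orientedVolume x q =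
    -∑ f, orientedTetra ![x (K.vert f 0), x (K.vert f 1), x (K.vert f 2), q] := by
  unfold orientedVolume
  rw [← Finset.sum_neg_distrib]
  refine Finset.sum_congr rfl fun f _ => ?_
  rw [orientedTetra_vecFour, K.range_vert, Left.sign_neg, side]
  have : insert q {x (K.vert f 0), x (K.vert f 1), x (K.vert f 2)}
      = ({x (K.vert f 0), x (K.vert f 1), x (K.vert f 2), q} : Set S3) := by
    ext; simp; tauto
  rw [this]
  simp

theorem IsNondegenerate.linearIndependent {K : OrientedTriangulation V F} {x : V → S3}
    (hx : K.IsNondegenerate x) (f : F) (i : Fin 3) : LinearIndependent ℝ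
      ![(x (K.vert f i) : E4), x (K.vert f (i + 1)), x (K.vert f (i + 2))] := by
  have h := (hx f).comp (fun j : Fin 3 => i + j) (add_right_injective i)
  convert h using 1
  ext j : 1; fin_cases j <;> simp

theorem IsNondegenerate.ae_isGeneric [Fintype F] {K : OrientedTriangulation V F} {x : V → S3}
    (hx : K.IsNondegenerate x) : ∀ᵐ z ∂sphereVolume, K.IsGeneric x z := by
  unfold IsGeneric
  rw [ae_all_iff]
  exact fun f => ae_det4_ne_zero (by simpa using hx.linearIndependent f 0)

theorem IsNondegenerate.exists_isGeneric [Fintype F] {K : OrientedTriangulation V F} {x : V → S3}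
    (hx : K.IsNondegenerate x) : ∃ q, K.IsGeneric x q :=
  hx.ae_isGeneric.exists

/-- Three vertices on the same triangle with an apex in general position. -/
theorem IsGeneric.linearIndependent {K : OrientedTriangulation V F} {x : V → S3} {q : S3}
    (hq : K.IsGeneric x q) (f : F) (i : Fin 3) : LinearIndependent ℝ
      ![(x (K.vert f i) : E4), x (K.vert f (i + 1)), x (K.vert f (i + 2)), q] := by
  have h := hq f
  rw [side, det4_eq_rowDet] at h
  rw [linearIndependent_iff_rowDet_ne_zero]
  fin_cases i
  · simpa using h
  · change rowDet ![_, _, (x (K.vert f 0) : E4), _] ≠ 0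
    rw [rowDet_swap₁₂, rowDet_swap₀₁]
    simpa using h
  · change rowDet ![_, (x (K.vert f 0) : E4), (x (K.vert f 1) : E4), _] ≠ 0
    rw [rowDet_swap₀₁, rowDet_swap₁₂]
    simpa using h

theorem IsGeneric.linearIndependent_edge {K : OrientedTriangulation V F} {x : V → S3} {q : S3}
    (hq : K.IsGeneric x q) (f : F) (i : Fin 3) : LinearIndependent ℝ
      ![(q : E4), x (K.vert f i), x (K.vert f (i + 1))] := by
  convert (hq.linearIndependent f i).comp ![3, 0, 1] (by decide) using 1
  ext j : 1; fin_cases j <;> rfl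

/-- The 4-simplex relations are added over all triangles; the tetrahedra over `p`, `r` and an edge
change sign with the direction of the edge. -/
theorem orientedVolume_eq_of_generic_pair [Fintype F] {x : V → S3} {p r : S3}
    (hp : K.IsGeneric x p) (hr : K.IsGeneric x r)
    (hpr : ∀ f i, det4 p r (x (K.vert f i)) (x (K.vert f (i + 1))) ≠ 0) :
    (K.orientedVolume x p : AddCircle (2 * Real.pi ^ 2)) = K.orientedVolume x r := by
  have H : ∀ f, ∃ k : ℤ, orientedTetra ![x (K.vert f 0), x (K.vert f 1), x (K.vert f 2), p]
      - orientedTetra ![x (K.vert f 0), x (K.vert f 1), x (K.vert f 2), r]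
      + ∑ i, orientedTetra ![p, r, x (K.vert f i), x (K.vert f (i + 1))]
      = k * (2 * Real.pi ^ 2) := fun f => by
    obtain ⟨k, hk⟩ := exists_sum_orientedTetra (hr f) (hp f) (hpr f 1) (hpr f 2) (hpr f 0)
    exact ⟨k, by rw [Fin.sum_univ_three]; exact hk⟩
  choose k hk using H
  have h1 := Finset.sum_congr (rfl : (Finset.univ : Finset F) = _) fun f _ => hk f
  rw [Finset.sum_add_distrib, Finset.sum_sub_distrib, K.sum_eq_zero_of_opposite
    (fun f i => orientedTetra ![p, r, x (K.vert f i), x (K.vert f (i + 1))])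
    (fun f i g j e1 e2 => by rw [e1, e2, orientedTetra_swap₂₃]; ring),
    ← Finset.sum_mul] at h1
  rw [← sub_eq_zero, ← AddCircle.coe_sub, AddCircle.coe_eq_zero_iff]
  refine ⟨-∑ f, k f, ?_⟩
  rw [orientedVolume_eq, orientedVolume_eq, zsmul_eq_mul]
  push_cast
  linarith

/-- The class of the oriented volume does not depend on the apex. -/
theorem orientedVolume_eq_of_isGeneric [Fintype F] {x : V → S3} (hx : K.IsNondegenerate x)
    {p q : S3} (hp : K.IsGeneric x p) (hq : K.IsGeneric x q) :
    (K.orientedVolume x p : AddCircle (2 * Real.pi ^ 2)) = K.orientedVolume x q := by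
  have edge : ∀ {p : S3}, K.IsGeneric x p → ∀ᵐ z ∂sphereVolume, ∀ f i,
      det4 p z (x (K.vert f i)) (x (K.vert f (i + 1))) ≠ 0 := fun {p} hp => by
    rw [ae_all_iff]; intro f
    rw [ae_all_iff]; intro i
    filter_upwards [ae_det4_ne_zero (hp.linearIndependent_edge f i)] with z hz
    rw [det4_eq_rowDet] at hz ⊢
    rw [rowDet_swap₁₂, rowDet_swap₂₃, neg_neg]
    exact hz
  -- The points `p` and `q` may be in special position to each other and to an edge (for example `q
  -- = -p`), so the comparison passes through a third, generic apex.
  obtain ⟨r, hr, h1, h2⟩ := (hx.ae_isGeneric.and ((edge hp).and (edge hq))).exists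
  exact (K.orientedVolume_eq_of_generic_pair hp hr h1).trans
    (K.orientedVolume_eq_of_generic_pair hq hr h2).symm

end OrientedTriangulation

/-! ### Gram determinants and rotation rates of triangles about an edge. -/

/-- The Gram determinant of two vectors. -/
def gramTwo (a b : E4) : ℝ := ⟪a, a⟫ * ⟪b, b⟫ - ⟪a, b⟫ ^ 2

/-- The Gram determinant of three vectors. -/
def gramThree (a b c : E4) : ℝ :=
  ⟪a, a⟫ * (⟪b, b⟫ * ⟪c, c⟫ - ⟪b, c⟫ ^ 2) - ⟪a, b⟫ * (⟪a, b⟫ * ⟪c, c⟫ - ⟪b, c⟫ * ⟪a, c⟫)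
    + ⟪a, c⟫ * (⟪a, b⟫ * ⟪b, c⟫ - ⟪b, b⟫ * ⟪a, c⟫)

/-- The mixed Gram determinant of `a, b, c` and `a, b, d`. -/
def gramMixed (a b c d : E4) : ℝ :=
  ⟪c, d⟫ * gramTwo a b - ⟪a, c⟫ * (⟪b, b⟫ * ⟪a, d⟫ - ⟪a, b⟫ * ⟪b, d⟫)
    - ⟪b, c⟫ * (⟪a, a⟫ * ⟪b, d⟫ - ⟪a, b⟫ * ⟪a, d⟫)

/-- The first variation of `gramTwo`. -/
def gramTwoVar (a b a' b' : E4) : ℝ :=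
  2 * ⟪a, a'⟫ * ⟪b, b⟫ + 2 * ⟪a, a⟫ * ⟪b, b'⟫ - 2 * ⟪a, b⟫ * (⟪a, b'⟫ + ⟪a', b⟫)

/-- The first variation of `gramMixed`. -/
def gramMixedVar (a b c d a' b' c' d' : E4) : ℝ :=
  (⟪c, d'⟫ + ⟪c', d⟫) * gramTwo a b + ⟪c, d⟫ * gramTwoVar a b a' b'
    - ((⟪a, c'⟫ + ⟪a', c⟫) * (⟪b, b⟫ * ⟪a, d⟫ - ⟪a, b⟫ * ⟪b, d⟫)
      + ⟪a, c⟫ * (2 * ⟪b, b'⟫ * ⟪a, d⟫ + ⟪b, b⟫ * (⟪a, d'⟫ + ⟪a', d⟫)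
        - (⟪a, b'⟫ + ⟪a', b⟫) * ⟪b, d⟫ - ⟪a, b⟫ * (⟪b, d'⟫ + ⟪b', d⟫)))
    - ((⟪b, c'⟫ + ⟪b', c⟫) * (⟪a, a⟫ * ⟪b, d⟫ - ⟪a, b⟫ * ⟪a, d⟫)
      + ⟪b, c⟫ * (2 * ⟪a, a'⟫ * ⟪b, d⟫ + ⟪a, a⟫ * (⟪b, d'⟫ + ⟪b', d⟫)
        - (⟪a, b'⟫ + ⟪a', b⟫) * ⟪a, d⟫ - ⟪a, b⟫ * (⟪a, d'⟫ + ⟪a', d⟫)))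

/-- Up to the factor `gramThree a b c`, the angular velocity of the triangle `a, b, c` about its
edge `a, b`. -/
def edgeRate (a b c a' b' c' : E4) : ℝ :=
  (⟪a, b⟫ * ⟪b, c⟫ - ⟪b, b⟫ * ⟪a, c⟫) * rowDet ![a, b, c, a']
    - (⟪a, a⟫ * ⟪b, c⟫ - ⟪a, b⟫ * ⟪a, c⟫) * rowDet ![a, b, c, b']
    + gramTwo a b * rowDet ![a, b, c, c']

theorem rowDet_eq_mul_rowDet_repr (e : OrthonormalBasis (Fin 4) ℝ E4) (v : Fin 4 → E4) :
    rowDet v = rowDet (fun i => e.repr (v i)) * rowDet e := by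
  unfold rowDet
  rw [← Matrix.det_mul]
  congr 1
  ext i j
  rw [Matrix.mul_apply]
  have h := congrArg (fun w : E4 => w j) (e.sum_repr (v i))
  simp only [WithLp.ofLp_sum, WithLp.ofLp_smul, Finset.sum_apply, Pi.smul_apply,
    smul_eq_mul] at h
  exact h.symm

theorem rowDet_vecFour_expand (a b c d : E4) : rowDet ![a, b, c, d] =
    a 0 * (b 1 * (c 2 * d 3 - c 3 * d 2) - b 2 * (c 1 * d 3 - c 3 * d 1)
      + b 3 * (c 1 * d 2 - c 2 * d 1))
    - a 1 * (b 0 * (c 2 * d 3 - c 3 * d 2) - b 2 * (c 0 * d 3 - c 3 * d 0)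
      + b 3 * (c 0 * d 2 - c 2 * d 0))
    + a 2 * (b 0 * (c 1 * d 3 - c 3 * d 1) - b 1 * (c 0 * d 3 - c 3 * d 0)
      + b 3 * (c 0 * d 1 - c 1 * d 0))
    - a 3 * (b 0 * (c 1 * d 2 - c 2 * d 1) - b 1 * (c 0 * d 2 - c 2 * d 0)
      + b 2 * (c 0 * d 1 - c 1 * d 0)) := by
  unfold rowDet
  simp [Matrix.det_succ_row_zero, Fin.sum_univ_succ, Fin.succAbove]
  ring

/-- The angular velocities of two triangles about a common edge and the variation of the angle
between them. -/
theorem edgeRate_identity (a b c d a' b' c' d' : E4) :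
    gramMixed a b c d * (gramTwoVar a b a' b' / 2 * rowDet ![a, b, c, d] + gramTwo a b *
      (rowDet ![a', b, c, d] + rowDet ![a, b', c, d] + rowDet ![a, b, c', d]
        + rowDet ![a, b, c, d']))
      - gramMixedVar a b c d a' b' c' d' * gramTwo a b * rowDet ![a, b, c, d]
    = gramThree a b c * edgeRate a b d a' b' d' - gramThree a b d * edgeRate a b c a' b' c' := by
  -- In the Gram–Schmidt frame of `a, b, c, d` half of the off-diagonal coordinates vanish, and a
  -- polynomial identity remains.
  obtain ⟨e, tri⟩ : ∃ e : OrthonormalBasis (Fin 4) ℝ E4, ∀ i j : Fin 4, i < j →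
      e.repr (![a, b, c, d] i) j = 0 :=
    ⟨_, fun i j hij => InnerProductSpace.gramSchmidtOrthonormalBasis_inv_triangular'
      (𝕜 := ℝ) (by simp) ![a, b, c, d] hij⟩
  have ha1 : e.repr a 1 = 0 := tri 0 1 (by decide)
  have ha2 : e.repr a 2 = 0 := tri 0 2 (by decide)
  have ha3 : e.repr a 3 = 0 := tri 0 3 (by decide)
  have hb2 : e.repr b 2 = 0 := tri 1 2 (by decide)
  have hb3 : e.repr b 3 = 0 := tri 1 3 (by decide)
  have hc3 : e.repr c 3 = 0 := tri 2 3 (by decide)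
  -- Every term of the identity has exactly one determinant factor, so the value of `δ` does not
  -- matter.
  obtain ⟨δ, hδ⟩ : ∃ δ, rowDet e = δ := ⟨_, rfl⟩
  have hdet : ∀ p q r s : E4, rowDet ![p, q, r, s]
      = rowDet ![e.repr p, e.repr q, e.repr r, e.repr s] * δ := fun p q r s => by
    rw [rowDet_eq_mul_rowDet_repr e, hδ]
    congr 2
    ext i : 1; fin_cases i <;> rfl
  simp only [rowDet_vecFour_expand (e.repr _)] at hdet
  have hin : ∀ p q : E4, ⟪p, q⟫ = e.repr p 0 * e.repr q 0 + e.repr p 1 * e.repr q 1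
      + e.repr p 2 * e.repr q 2 + e.repr p 3 * e.repr q 3 := fun p q => by
    rw [← e.repr.inner_map_map p q, PiLp.inner_apply, Fin.sum_univ_four]
    simp [mul_comm]
  simp only [gramMixed, gramMixedVar, gramTwo, gramTwoVar, gramThree, edgeRate, hdet, hin,
     ha1, ha2, ha3, hb2, hb3, hc3, mul_zero, zero_mul, add_zero, sub_zero]
  ring

/-! ### Fluxes through the faces of a moving tetrahedron. -/

theorem measurePreserving_orthant_perm {n : ℕ} (e : Equiv.Perm (Fin n)) :
    MeasurePreserving (MeasurableEquiv.piCongrLeft (fun _ : Fin n => ℝ) e)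
      (orthantMeasure n) (orthantMeasure n) :=
  measurePreserving_piCongrLeft (fun _ : Fin n => (volume : Measure ℝ).restrict (Set.Ici 0)) e

section

variable {E : Type*} [NormedAddCommGroup E] [InnerProductSpace ℝ E] {n : ℕ}

theorem piCongrLeft_perm_apply (e : Equiv.Perm (Fin n)) (r : Fin n → ℝ) (k : Fin n) :
    MeasurableEquiv.piCongrLeft (fun _ : Fin n => ℝ) e r (e k) = r k :=
  Equiv.piCongrLeft_apply_apply (P := fun _ : Fin n => ℝ) e r k

theorem gaussWeight_comp_perm (v : Fin n → E) (e : Equiv.Perm (Fin n)) (r : Fin n → ℝ) :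
    gaussWeight v (MeasurableEquiv.piCongrLeft (fun _ : Fin n => ℝ) e r)
      = gaussWeight (v ∘ e) r := by
  unfold gaussWeight
  rw [← Equiv.sum_comp e]
  simp only [piCongrLeft_perm_apply, Function.comp_apply]

theorem coneIntegral_comp_perm (v : Fin n → E) (e : Equiv.Perm (Fin n)) :
    coneIntegral (v ∘ e) = coneIntegral v := by
  unfold coneIntegral
  rw [← (measurePreserving_orthant_perm e).integral_comp' (gaussWeight v)]
  simp only [gaussWeight_comp_perm]

theorem coneMoment_comp_perm (v : Fin n → E) (e : Equiv.Perm (Fin n)) (k : Fin n) :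
    coneMoment (v ∘ e) k = coneMoment v (e k) := by
  unfold coneMoment
  rw [← (measurePreserving_orthant_perm e).integral_comp' (fun r => r (e k) * gaussWeight v r)]
  simp only [gaussWeight_comp_perm, piCongrLeft_perm_apply]

theorem coneIntegral_pair_comm (a b : E) : coneIntegral ![b, a] = coneIntegral ![a, b] := by
  rw [← coneIntegral_comp_perm ![a, b] (Equiv.swap 0 1)]
  congr 1
  ext i : 1; fin_cases i <;> rfl

theorem coneMoment_swap (a b c : E) (k : Fin 3) :
    coneMoment ![b, a, c] k = coneMoment ![a, b, c] (Equiv.swap 0 1 k) := by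
  rw [← coneMoment_comp_perm ![a, b, c] (Equiv.swap 0 1)]
  congr 1
  ext i : 1; fin_cases i <;> rfl

end

/-- The flux of the variation through the side face `a, b, q` of a cone with the fixed apex `q`. -/
def sideFlux (q a b a' b' : E4) : ℝ :=
  rowDet ![a, b, a', q] * coneMoment ![a, b, q] 0 + rowDet ![a, b, b', q] * coneMoment ![a, b, q] 1

/-- The flux of the variation through the base of a cone. -/
def baseFlux (a b c a' b' c' : E4) : ℝ :=
  rowDet ![a, b, c, a'] * coneMoment ![a, b, c] 0 + rowDet ![a, b, c, b'] * coneMoment ![a, b, c] 1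
    + rowDet ![a, b, c, c'] * coneMoment ![a, b, c] 2

/-- Neighbouring triangles share the side face over their common edge with opposite orientations;
this antisymmetry makes the side fluxes cancel. -/
theorem sideFlux_swap (q a b a' b' : E4) : sideFlux q b a b' a' = -sideFlux q a b a' b' := by
  unfold sideFlux
  rw [coneMoment_swap a b q, coneMoment_swap a b q, rowDet_swap₀₁ a b, rowDet_swap₀₁ a b]
  simp only [Equiv.swap_apply_left, Equiv.swap_apply_right]
  ring

theorem update_vecFour_zero (a b c d x : E4) :
    Function.update ![a, b, c, d] 0 x = ![x, b, c, d] := by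
  ext i : 1; fin_cases i <;> rfl

theorem update_vecFour_one (a b c d x : E4) :
    Function.update ![a, b, c, d] 1 x = ![a, x, c, d] := by
  ext i : 1; fin_cases i <;> rfl

theorem update_vecFour_two (a b c d x : E4) :
    Function.update ![a, b, c, d] 2 x = ![a, b, x, d] := by
  ext i : 1; fin_cases i <;> rfl

theorem update_vecFour_three (a b c d x : E4) :
    Function.update ![a, b, c, d] 3 x = ![a, b, c, x] := by
  ext i : 1; fin_cases i <;> rfl

theorem hasDerivAt_vecFour {a b c d : ℝ → E4} {a' b' c' d' : E4} {t : ℝ}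
    (ha : HasDerivAt a a' t) (hb : HasDerivAt b b' t) (hc : HasDerivAt c c' t)
    (hd : HasDerivAt d d' t) :
    HasDerivAt (fun s => ![a s, b s, c s, d s]) ![a', b', c', d'] t := by
  rw [hasDerivAt_pi]
  intro i
  fin_cases i
  exacts [ha, hb, hc, hd]

theorem hasDerivAt_rowDet_vecFour {a b c d : ℝ → E4} {a' b' c' d' : E4} {t : ℝ}
    (ha : HasDerivAt a a' t) (hb : HasDerivAt b b' t) (hc : HasDerivAt c c' t)
    (hd : HasDerivAt d d' t) :
    HasDerivAt (fun s => rowDet ![a s, b s, c s, d s])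
      (rowDet ![a', b t, c t, d t] + rowDet ![a t, b', c t, d t] + rowDet ![a t, b t, c', d t]
        + rowDet ![a t, b t, c t, d']) t := by
  obtain ⟨L, hL, hLw⟩ := hasFDerivAt_rowDet ![a t, b t, c t, d t]
  refine (hL.comp_hasDerivAt t (hasDerivAt_vecFour ha hb hc hd)).congr_deriv ?_
  rw [hLw, Fin.sum_univ_four, update_vecFour_zero, update_vecFour_one, update_vecFour_two,
    update_vecFour_three]
  rfl

/-- The apex has velocity zero. The three facets through it give the side fluxes, the facet opposite
to it the base flux. -/
theorem hasDerivAt_tetra {a b c : ℝ → E4} {q a' b' c' : E4} {t : ℝ} (ha : HasDerivAt a a' t)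
    (hb : HasDerivAt b b' t) (hc : HasDerivAt c c' t)
    (hli : LinearIndependent ℝ ![a t, b t, c t, q]) :
    HasDerivAt (fun s => rowDet ![a s, b s, c s, q] * coneIntegral ![a s, b s, c s, q])
      (-(sideFlux q (a t) (b t) a' b' + sideFlux q (b t) (c t) b' c' + sideFlux q (c t) (a t) c' a'
        + baseFlux (a t) (b t) (c t) a' b' c')) t := by
  obtain ⟨L, hL, hLw⟩ := hasFDerivAt_rowDet_mul_coneIntegral hli
  have hcurve := hasDerivAt_vecFour ha hb hc (hasDerivAt_const t q)
  refine (hL.comp_hasDerivAt t hcurve).congr_deriv ?_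
  rw [hLw]
  generalize a t = a, b t = b, c t = c
  have s0 : (fun i => ![a, b, c, q] ((0 : Fin 4).succAbove i)) = ![b, c, q] := by
    ext i : 1; fin_cases i <;> rfl
  have s1 : (fun i => ![a, b, c, q] ((1 : Fin 4).succAbove i)) = ![a, c, q] := by
    ext i : 1; fin_cases i <;> rfl
  have s2 : (fun i => ![a, b, c, q] ((2 : Fin 4).succAbove i)) = ![a, b, q] := by
    ext i : 1; fin_cases i <;> rfl
  have s3 : (fun i => ![a, b, c, q] ((3 : Fin 4).succAbove i)) = ![a, b, c] := by
    ext i : 1; fin_cases i <;> rfl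
  have z0 : rowDet ![0, b, c, q] = 0 := by simp [rowDet_vecFour_expand]
  have z1 : rowDet ![a, 0, c, q] = 0 := by simp [rowDet_vecFour_expand]
  have z2 : rowDet ![a, b, 0, q] = 0 := by simp [rowDet_vecFour_expand]
  have t0 : ∑ k : Fin 3, rowDet (Function.update ![a, b, c, q] 0
      (![a', b', c', 0] ((0 : Fin 4).succAbove k))) * coneMoment ![b, c, q] k
      = rowDet ![b', b, c, q] * coneMoment ![b, c, q] 0
        + rowDet ![c', b, c, q] * coneMoment ![b, c, q] 1
        + rowDet ![0, b, c, q] * coneMoment ![b, c, q] 2 := by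
    simp only [update_vecFour_zero]
    exact Fin.sum_univ_three _
  have t1 : ∑ k : Fin 3, rowDet (Function.update ![a, b, c, q] 1
      (![a', b', c', 0] ((1 : Fin 4).succAbove k))) * coneMoment ![a, c, q] k
      = rowDet ![a, a', c, q] * coneMoment ![a, c, q] 0
        + rowDet ![a, c', c, q] * coneMoment ![a, c, q] 1
        + rowDet ![a, 0, c, q] * coneMoment ![a, c, q] 2 := by
    simp only [update_vecFour_one]
    exact Fin.sum_univ_three _
  have t2 : ∑ k : Fin 3, rowDet (Function.update ![a, b, c, q] 2
      (![a', b', c', 0] ((2 : Fin 4).succAbove k))) * coneMoment ![a, b, q] k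
      = rowDet ![a, b, a', q] * coneMoment ![a, b, q] 0
        + rowDet ![a, b, b', q] * coneMoment ![a, b, q] 1
        + rowDet ![a, b, 0, q] * coneMoment ![a, b, q] 2 := by
    simp only [update_vecFour_two]
    exact Fin.sum_univ_three _
  have t3 : ∑ k : Fin 3, rowDet (Function.update ![a, b, c, q] 3
      (![a', b', c', 0] ((3 : Fin 4).succAbove k))) * coneMoment ![a, b, c] k
      = rowDet ![a, b, c, a'] * coneMoment ![a, b, c] 0
        + rowDet ![a, b, c, b'] * coneMoment ![a, b, c] 1
        + rowDet ![a, b, c, c'] * coneMoment ![a, b, c] 2 := by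
    simp only [update_vecFour_three]
    exact Fin.sum_univ_three _
  refine (congrArg Neg.neg (Fin.sum_univ_four _)).trans ?_
  rw [s0, s1, s2, s3]
  refine (congrArg Neg.neg (congrArg₂ (· + ·) (congrArg₂ (· + ·) (congrArg₂ (· + ·) t0 t1) t2)
    t3)).trans ?_
  rw [z0, z1, z2]
  unfold sideFlux baseFlux
  rw [coneMoment_swap a c q, coneMoment_swap a c q]
  simp only [Equiv.swap_apply_left, Equiv.swap_apply_right]
  have r : ∀ x y z : E4, rowDet ![x, y, z, q] = rowDet ![y, z, x, q] := fun x y z => by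
    rw [rowDet_swap₀₁, rowDet_swap₁₂, neg_neg]
  rw [r b' b c, r c' b c, r c a c', r c a a', rowDet_swap₁₂ a c, rowDet_swap₁₂ a c]
  ring

theorem gramTwo_pos {a b : E4} (h : LinearIndependent ℝ ![a, b]) : 0 < gramTwo a b := by
  have := (Matrix.posDef_gram_of_linearIndependent (𝕜 := ℝ) h).det_pos
  rw [Matrix.det_fin_two] at this
  simp only [Matrix.gram_apply] at this
  simp only [Matrix.cons_val] at this
  unfold gramTwo
  rw [real_inner_comm a b] at this
  linarith

theorem gramThree_pos {a b c : E4} (h : LinearIndependent ℝ ![a, b, c]) :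
    0 < gramThree a b c := by
  have := (Matrix.posDef_gram_of_linearIndependent (𝕜 := ℝ) h).det_pos
  rw [Matrix.det_fin_three] at this
  simp only [Matrix.gram_apply] at this
  simp only [Matrix.cons_val] at this
  unfold gramThree
  rw [real_inner_comm a b, real_inner_comm a c, real_inner_comm b c] at this
  linarith

/-- The flux through the base is a sum over its edges. -/
theorem baseFlux_eq {a b c : E4} (h : LinearIndependent ℝ ![a, b, c]) (a' b' c' : E4) :
    baseFlux a b c a' b' c' = coneIntegral ![a, b] * (edgeRate a b c a' b' c' / gramThree a b c)
      + coneIntegral ![b, c] * (edgeRate b c a b' c' a' / gramThree b c a)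
      + coneIntegral ![c, a] * (edgeRate c a b c' a' b' / gramThree c a b) := by
  have hD := (gramThree_pos h).ne'
  have g1 : gramThree b c a = gramThree a b c := by
    unfold gramThree
    rw [real_inner_comm a b, real_inner_comm a c]; ring
  have g2 : gramThree c a b = gramThree a b c := by
    unfold gramThree
    rw [real_inner_comm b c, real_inner_comm a c]; ring
  -- The facets of the three-dimensional cone are its edges: `e0`, `e1`, `e2` are the Gram system
  -- for the first moments. Substituting them for the edge integrals reduces the claim to an
  -- algebraic identity.
  have e0 : coneIntegral ![b, c] = ⟪a, a⟫ * coneMoment ![a, b, c] 0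
      + ⟪b, a⟫ * coneMoment ![a, b, c] 1 + ⟪c, a⟫ * coneMoment ![a, b, c] 2 := by
    have e := sum_inner_mul_coneMoment h 0
    have s : (fun i => ![a, b, c] ((0 : Fin 3).succAbove i)) = ![b, c] := by
      ext i : 1; fin_cases i <;> rfl
    rw [s] at e
    exact e.symm.trans (Fin.sum_univ_three _)
  have e1 : coneIntegral ![c, a] = ⟪a, b⟫ * coneMoment ![a, b, c] 0
      + ⟪b, b⟫ * coneMoment ![a, b, c] 1 + ⟪c, b⟫ * coneMoment ![a, b, c] 2 := by
    have e := sum_inner_mul_coneMoment h 1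
    have s : (fun i => ![a, b, c] ((1 : Fin 3).succAbove i)) = ![a, c] := by
      ext i : 1; fin_cases i <;> rfl
    rw [s, ← coneIntegral_pair_comm] at e
    exact e.symm.trans (Fin.sum_univ_three _)
  have e2 : coneIntegral ![a, b] = ⟪a, c⟫ * coneMoment ![a, b, c] 0
      + ⟪b, c⟫ * coneMoment ![a, b, c] 1 + ⟪c, c⟫ * coneMoment ![a, b, c] 2 := by
    have e := sum_inner_mul_coneMoment h 2
    have s : (fun i => ![a, b, c] ((2 : Fin 3).succAbove i)) = ![a, b] := by
      ext i : 1; fin_cases i <;> rfl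
    rw [s] at e
    exact e.symm.trans (Fin.sum_univ_three _)
  have r : ∀ x y z q : E4, rowDet ![x, y, z, q] = rowDet ![y, z, x, q] := fun x y z q => by
    rw [rowDet_swap₀₁, rowDet_swap₁₂, neg_neg]
  rw [e0, e1, e2, g1, g2]
  unfold baseFlux edgeRate
  rw [← r a b c, ← r a b c, ← r a b c, r c a b, r c a b, r c a b]
  field_simp
  unfold gramThree gramTwo
  rw [real_inner_comm a b, real_inner_comm a c, real_inner_comm b c]
  ring

/-! ### Differentiation of a fixed dihedral angle. -/

/-- This turns the projections in `dihedralAngle` into a polynomial in inner products, which can be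
differentiated; it follows from the normal equations for the projection of `c`. -/
theorem gramTwo_mul_inner_starProjection (a b c d : E4) :
    gramTwo a b * ⟪(Submodule.span ℝ {a, b})ᗮ.starProjection c,
      (Submodule.span ℝ {a, b})ᗮ.starProjection d⟫ = gramMixed a b c d := by
  set W := Submodule.span ℝ {a, b}
  have haW : a ∈ W := Submodule.subset_span (by simp)
  have hbW : b ∈ W := Submodule.subset_span (by simp)
  obtain ⟨α, β, hy⟩ := Submodule.mem_span_pair.1 (W.starProjection_apply_mem c)
  have ha := W.starProjection_inner_eq_zero c a haW
  have hb := W.starProjection_inner_eq_zero c b hbW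
  have h1 : ⟪Wᗮ.starProjection c, Wᗮ.starProjection d⟫ = ⟪c, d⟫ - ⟪W.starProjection c, d⟫ := by
    rw [← Submodule.inner_starProjection_left_eq_right, ← inner_sub_left]
    congr 1
    rw [Submodule.starProjection_eq_self_iff.2 (Submodule.starProjection_apply_mem _ _)]
    rw [Submodule.starProjection_orthogonal_val]
  rw [h1]
  rw [← hy] at ha hb ⊢
  simp only [inner_sub_left, inner_add_left, real_inner_smul_left] at ha hb ⊢
  unfold gramMixed gramTwo
  rw [real_inner_comm a c] at ha
  rw [real_inner_comm b c] at hb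
  rw [real_inner_comm a b] at ha
  linear_combination (⟪b, b⟫ * ⟪a, d⟫ - ⟪a, b⟫ * ⟪b, d⟫) * ha +
    (⟪a, a⟫ * ⟪b, d⟫ - ⟪a, b⟫ * ⟪a, d⟫) * hb

/-- The dihedral angle fixes the ratio of the mixed Gram determinant and the determinant. -/
theorem sin_dihedralAngle_mul_add (a b c d : S3) :
    Real.sin (dihedralAngle a b c d) * gramMixed a b c d + Real.cos (dihedralAngle a b c d) *
      (√(gramTwo (a : E4) b) * rowDet ![(a : E4), b, c, d]) = 0 := by
  have hQ : gramTwo (a : E4) b = 1 - ⟪(a : E4), b⟫ ^ 2 := by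
    simp [gramTwo]
  have hQ0 : 0 ≤ gramTwo (a : E4) b := by
    rw [hQ, sub_nonneg, sq_le_one_iff_abs_le_one]
    simpa using abs_real_inner_le_norm (a : E4) b
  -- A relation linear in the real and imaginary parts avoids the branch cut of `arg` and holds for
  -- `z = 0` as well.
  have key : ∀ z : ℂ, √(gramTwo (a : E4) b) * z.re = gramMixed (a : E4) b c d →
      z.im = -det4 a b c d → Real.sin (toIcoMod Real.two_pi_pos 0 z.arg) * gramMixed (a : E4) b c d
        + Real.cos (toIcoMod Real.two_pi_pos 0 z.arg) *
          (√(gramTwo (a : E4) b) * det4 a b c d) = 0 := fun z hre him => by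
    simp only [toIcoMod, zsmul_eq_mul, Real.sin_sub_int_mul_two_pi, Real.cos_sub_int_mul_two_pi]
    rw [← hre, ← neg_neg (det4 a b c d), ← him, ← Complex.norm_mul_cos_arg z,
      ← Complex.norm_mul_sin_arg z]
    simp only [Complex.norm_mul_cos_arg, Complex.norm_mul_sin_arg]
    rw [← Complex.norm_mul_cos_arg z, ← Complex.norm_mul_sin_arg z]
    ring
  unfold dihedralAngle
  rw [← det4_eq_rowDet]
  refine key _ ?_ rfl
  rw [← gramTwo_mul_inner_starProjection, ← hQ, ← mul_assoc, Real.mul_self_sqrt hQ0]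

/-- With `σ, κ` fixed, the pair `(gramMixed, √gramTwo * rowDet)` stays on one line through the
origin, so its Wronskian vanishes. By `edgeRate_identity`, `√gramTwo` times the Wronskian is the
difference of the two sides. -/
theorem edgeRate_eq_of_dihedral {a b c d : ℝ → E4} {a' b' c' d' : E4} {t σ κ : ℝ}
    (ha : HasDerivAt a a' t) (hb : HasDerivAt b b' t) (hc : HasDerivAt c c' t)
    (hd : HasDerivAt d d' t) (hQ : 0 < gramTwo (a t) (b t)) (hσκ : σ ^ 2 + κ ^ 2 = 1)
    (h : ∀ᶠ s in 𝓝 t, σ * gramMixed (a s) (b s) (c s) (d s) + κ *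
      (√(gramTwo (a s) (b s)) * rowDet ![a s, b s, c s, d s]) = 0) :
    gramThree (a t) (b t) (c t) * edgeRate (a t) (b t) (d t) a' b' d'
      = gramThree (a t) (b t) (d t) * edgeRate (a t) (b t) (c t) a' b' c' := by
  have dot : ∀ {x y : ℝ → E4} {x' y' : E4}, HasDerivAt x x' t → HasDerivAt y y' t →
      HasDerivAt (fun s => ⟪x s, y s⟫) (⟪x t, y'⟫ + ⟪x', y t⟫) t := fun hx hy => hx.inner ℝ hy
  have hQd : HasDerivAt (fun s => gramTwo (a s) (b s)) (gramTwoVar (a t) (b t) a' b') t := by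
    refine (((dot ha ha).mul (dot hb hb)).sub ((dot ha hb).pow 2)).congr_deriv ?_
    unfold gramTwoVar
    rw [real_inner_comm (a t) a', real_inner_comm (b t) b']
    norm_num
    ring
  have hRd : HasDerivAt (fun s => gramMixed (a s) (b s) (c s) (d s))
      (gramMixedVar (a t) (b t) (c t) (d t) a' b' c' d') t := by
    refine ((((dot hc hd).mul hQd).sub ((dot ha hc).mul
      (((dot hb hb).mul (dot ha hd)).sub ((dot ha hb).mul (dot hb hd))))).sub ((dot hb hc).mul
      (((dot ha ha).mul (dot hb hd)).sub ((dot ha hb).mul (dot ha hd))))).congr_deriv ?_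
    unfold gramMixedVar
    rw [real_inner_comm (a t) a', real_inner_comm (b t) b']
    simp only [Pi.mul_apply, Pi.sub_apply]
    ring
  have hDd := hasDerivAt_rowDet_vecFour ha hb hc hd
  have hS := hQd.sqrt hQ.ne'
  have h0 := h.self_of_nhds
  have h1 : σ * gramMixedVar (a t) (b t) (c t) (d t) a' b' c' d' + κ * (_ + _) = 0 :=
    ((hRd.const_mul σ).add ((hS.mul hDd).const_mul κ)).unique
      ((hasDerivAt_const t (0 : ℝ)).congr_of_eventuallyEq h)
  have key := edgeRate_identity (a t) (b t) (c t) (d t) a' b' c' d'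
  rw [← sub_eq_zero, ← key]
  set D' := rowDet ![a', b t, c t, d t] + rowDet ![a t, b', c t, d t] + rowDet ![a t, b t, c', d t]
        + rowDet ![a t, b t, c t, d']
  set D := rowDet ![a t, b t, c t, d t]
  set R := gramMixed (a t) (b t) (c t) (d t)
  set R' := gramMixedVar (a t) (b t) (c t) (d t) a' b' c' d'
  set Q := gramTwo (a t) (b t)
  set Q' := gramTwoVar (a t) (b t) a' b'
  have hs : 0 < √Q := Real.sqrt_pos.2 hQ
  have hss : √Q * √Q = Q := Real.mul_self_sqrt hQ.le
  have h2 : σ * (R' * √Q) + κ * (Q' / 2 * D + Q * D') = 0 := by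
    have hq : √Q * (Q' / (2 * √Q)) = Q' / 2 := by field_simp
    linear_combination √Q * h1 - κ * D * hq - κ * D' * hss
  -- The relations `h0` and `h2` have the common nonzero solution `(σ, κ)`, so their determinant is
  -- zero.
  have h3 : R * (Q' / 2 * D + Q * D') - R' * √Q * (√Q * D) = 0 := by
    have e1 : σ * (R * (Q' / 2 * D + Q * D') - R' * √Q * (√Q * D)) = 0 := by
      linear_combination (Q' / 2 * D + Q * D') * h0 - (√Q * D) * h2
    have e2 : κ * (R * (Q' / 2 * D + Q * D') - R' * √Q * (√Q * D)) = 0 := by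
      linear_combination R * h2 - (R' * √Q) * h0
    linear_combination σ * e1 + κ * e2 - (R * (Q' / 2 * D + Q * D') - R' * √Q * (√Q * D)) * hσκ
  linear_combination h3 + R' * D * hss

theorem orientedTetra_mul_radialIntegral {a b c q : S3} (h : det4 a b c q ≠ 0) :
    orientedTetra ![a, b, c, q] * radialIntegral =
      rowDet ![(a : E4), b, c, q] * coneIntegral ![(a : E4), b, c, q] := by
  rw [det4_eq_rowDet, ← coe_vecFour] at h
  rw [orientedTetra, mul_assoc, sphereVolume_sphericalHull h, ← mul_assoc, coe_vecFour,
    sign_mul_abs]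

/-! ### Schläfli's formula and constancy of the class. -/

namespace OrientedTriangulation

variable {V F : Type*} (K : OrientedTriangulation V F)

/-- The oriented volume as a Gaussian integral, up to a constant factor. -/
def gaussianVolume [Fintype F] (x : V → S3) (q : S3) : ℝ :=
  ∑ f, rowDet ![(x (K.vert f 0) : E4), x (K.vert f 1), x (K.vert f 2), q] *
    coneIntegral ![(x (K.vert f 0) : E4), x (K.vert f 1), x (K.vert f 2), q]

theorem orientedVolume_mul_radialIntegral [Fintype F] {x : V → S3} {q : S3}
    (hq : K.IsGeneric x q) :
    K.orientedVolume x q * radialIntegral = -K.gaussianVolume x q := by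
  rw [orientedVolume_eq, neg_mul, Finset.sum_mul, gaussianVolume]
  exact congrArg _ (Finset.sum_congr rfl fun f _ => orientedTetra_mul_radialIntegral (hq f))

/-- The opposite edge has the same edge integral, while `edgeRate` changes its sign when the edge is
reversed; the fixed angle makes the rates of the two triangles equal. -/
theorem sum_edge_rates_eq_zero [Fintype F] {x : ℝ → V → S3} {w : V → E4} {t : ℝ}
    (hx : ∀ v, HasDerivAt (fun s => (x s v : E4)) (w v) t) (hnd : K.IsNondegenerate (x t))
    (hangle : ∀ f i g j, K.vert g j = K.vert f (i + 1) → K.vert g (j + 1) = K.vert f i →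
      ∃ θ, ∀ᶠ s in 𝓝 t, dihedralAngle (x s (K.vert f i)) (x s (K.vert f (i + 1)))
          (x s (K.vert f (i + 2))) (x s (K.vert g (j + 2))) = θ) :
    ∑ f, ∑ i, coneIntegral ![(x t (K.vert f i) : E4), x t (K.vert f (i + 1))] *
      (edgeRate (x t (K.vert f i)) (x t (K.vert f (i + 1))) (x t (K.vert f (i + 2)))
        (w (K.vert f i)) (w (K.vert f (i + 1))) (w (K.vert f (i + 2))) /
      gramThree (x t (K.vert f i)) (x t (K.vert f (i + 1))) (x t (K.vert f (i + 2)))) = 0 := by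
  refine K.sum_eq_zero_of_opposite _ fun f i g j h1 h2 => ?_
  obtain ⟨θ, hθ⟩ := hangle f i g j h1 h2
  have hf := hnd.linearIndependent f i
  have hg := hnd.linearIndependent g j
  rw [h1, h2] at hg ⊢
  have hQ : 0 < gramTwo (x t (K.vert f i) : E4) (x t (K.vert f (i + 1))) := by
    refine gramTwo_pos ?_
    convert hf.comp ![0, 1] (by decide) using 1
    ext k : 1; fin_cases k <;> rfl
  have key := edgeRate_eq_of_dihedral (hx (K.vert f i)) (hx (K.vert f (i + 1)))
    (hx (K.vert f (i + 2))) (hx (K.vert g (j + 2))) hQ (Real.sin_sq_add_cos_sq θ) (by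
      filter_upwards [hθ] with s hs
      rw [← hs]
      exact sin_dihedralAngle_mul_add _ _ _ _)
  have e1 : ∀ a b c a' b' c' : E4, edgeRate b a c b' a' c' = -edgeRate a b c a' b' c' := by
    intro a b c a' b' c'
    unfold edgeRate gramTwo
    rw [rowDet_swap₀₁ a b, rowDet_swap₀₁ a b, rowDet_swap₀₁ a b, real_inner_comm a b]
    ring
  have e2 : ∀ a b c : E4, gramThree b a c = gramThree a b c := by
    intro a b c
    unfold gramThree
    rw [real_inner_comm a b]
    ring
  have p1 := (gramThree_pos hf).ne'
  have p2 := (gramThree_pos hg).ne'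
  rw [coneIntegral_pair_comm (x t (K.vert f i) : E4),
    e1 (x t (K.vert f i)) _ (x t (K.vert g (j + 2))), e2 (x t (K.vert f i)) _ (x t (K.vert g (j + 2)))]
  rw [e2] at p2
  rw [← mul_add]
  refine mul_eq_zero_of_right _ ?_
  rw [div_add_div _ _ p1 p2, div_eq_zero_iff]
  left
  linear_combination -key

/-- **Schläfli's formula**: when the dihedral angles are fixed, the variation of the volume
vanishes. -/
theorem hasDerivAt_gaussianVolume [Fintype F] {x : ℝ → V → S3} {w : V → E4} {t : ℝ} {q : S3}
    (hx : ∀ v, HasDerivAt (fun s => (x s v : E4)) (w v) t) (hnd : K.IsNondegenerate (x t))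
    (hq : K.IsGeneric (x t) q)
    (hangle : ∀ f i g j, K.vert g j = K.vert f (i + 1) → K.vert g (j + 1) = K.vert f i →
      ∃ θ, ∀ᶠ s in 𝓝 t, dihedralAngle (x s (K.vert f i)) (x s (K.vert f (i + 1)))
          (x s (K.vert f (i + 2))) (x s (K.vert g (j + 2))) = θ) :
    HasDerivAt (fun s => K.gaussianVolume (x s) q) 0 t := by
  have h := HasDerivAt.fun_sum (u := Finset.univ) fun f _ => hasDerivAt_tetra
    (hx (K.vert f 0)) (hx (K.vert f 1)) (hx (K.vert f 2))
    (q := (q : E4)) (det4_ne_zero_iff.1 (hq f))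
  refine h.congr_deriv ?_
  have h1 := K.sum_edge_rates_eq_zero hx hnd hangle
  have h2 := K.sum_eq_zero_of_opposite
    (fun f i => sideFlux q (x t (K.vert f i)) (x t (K.vert f (i + 1)))
      (w (K.vert f i)) (w (K.vert f (i + 1))))
    (fun f i g j e1 e2 => by rw [e1, e2, sideFlux_swap]; ring)
  have h3 : ∀ f, baseFlux (x t (K.vert f 0)) (x t (K.vert f 1)) (x t (K.vert f 2))
      (w (K.vert f 0)) (w (K.vert f 1)) (w (K.vert f 2)) = _ :=
    fun f => baseFlux_eq (by simpa using hnd.linearIndependent f 0) _ _ _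
  rw [Finset.sum_neg_distrib, Finset.sum_add_distrib, Finset.sum_congr rfl fun f _ => h3 f]
  simp only [Fin.sum_univ_three] at h1 h2
  change -(∑ f, _ + ∑ f, _) = (0 : ℝ)
  rw [neg_eq_zero]
  refine (congrArg₂ (· + ·) h2 h1).trans (add_zero 0)

/-- The real number itself is constant while the apex stays generic. The endpoints may be endpoints
of `I`, so derivatives are used inside the interval only, with continuity up to its ends. -/
theorem orientedVolume_eq_of_Icc [Fintype F] {I : Set ℝ} {x : ℝ → V → S3}
    (hx : K.IsSmoothDeformation I x) (hangle : K.PreservesDihedralAngles I x) {a b : ℝ}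
    (hab : a < b) (hI : Set.Icc a b ⊆ I) {q : S3} (hq : ∀ s ∈ Set.Icc a b, K.IsGeneric (x s) q) :
    K.orientedVolume (x a) q = K.orientedVolume (x b) q := by
  have hcont : ContinuousOn (fun s => K.gaussianVolume (x s) q) (Set.Icc a b) := by
    refine continuousOn_finsetSum _ fun f _ s hs => ?_
    obtain ⟨L, hL, -⟩ := hasFDerivAt_rowDet_mul_coneIntegral (n := 3)
      (det4_ne_zero_iff.1 (hq s hs f))
    have hv : ∀ v, ContinuousWithinAt (fun s => (x s v : E4)) (Set.Icc a b) s := fun v =>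
      ((hx.1 v).continuousOn.mono hI) s hs
    refine ContinuousAt.comp_continuousWithinAt
      (f := fun s => ![(x s (K.vert f 0) : E4), x s (K.vert f 1), x s (K.vert f 2), q])
      hL.continuousAt ?_
    refine continuousWithinAt_pi.2 fun i => ?_
    fin_cases i
    exacts [hv _, hv _, hv _, continuousWithinAt_const]
  have hderiv : ∀ t ∈ Set.Ioo a b, HasDerivAt (fun s => K.gaussianVolume (x s) q) 0 t := by
    intro t ht
    have hnhds : I ∈ 𝓝 t := Filter.mem_of_superset (Icc_mem_nhds ht.1 ht.2) hI
    have htI : t ∈ I := mem_of_mem_nhds hnhds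
    refine K.hasDerivAt_gaussianVolume (w := fun v => deriv (fun s => (x s v : E4)) t)
      (fun v => ?_) (hx.2 t htI) (hq t ⟨ht.1.le, ht.2.le⟩) fun f i g j h1 h2 => ?_
    · exact (((hx.1 v).differentiableOn one_ne_zero t htI).differentiableAt hnhds).hasDerivAt
    · exact ⟨_, Filter.mem_of_superset hnhds fun s hs => hangle f i g j h1 h2 s hs t htI⟩
  obtain ⟨c, -, hc⟩ := exists_hasDerivAt_eq_slope _ (fun _ => (0 : ℝ)) hab hcont hderiv
  have h0 : K.gaussianVolume (x a) q = K.gaussianVolume (x b) q := by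
    have hba : b - a ≠ 0 := (sub_pos.2 hab).ne'
    rw [eq_comm, div_eq_zero_iff] at hc
    linarith [hc.resolve_right hba]
  refine mul_right_cancel₀ radialIntegral_ne_zero ?_
  rw [K.orientedVolume_mul_radialIntegral (hq a (Set.left_mem_Icc.2 hab.le)),
    K.orientedVolume_mul_radialIntegral (hq b (Set.right_mem_Icc.2 hab.le)), h0]

theorem eventually_isGeneric [Fintype F] {I : Set ℝ} {x : ℝ → V → S3}
    (hx : K.IsSmoothDeformation I x) {t : ℝ} (ht : t ∈ I) {q : S3} (hq : K.IsGeneric (x t) q) :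
    ∀ᶠ s in 𝓝[I] t, K.IsGeneric (x s) q := by
  unfold IsGeneric
  rw [Filter.eventually_all]
  intro f
  have hv : ∀ v, ContinuousWithinAt (fun s => (x s v : E4)) I t := fun v =>
    (hx.1 v).continuousOn t ht
  have hc : ContinuousWithinAt (fun s => K.side (x s) f q) I t := by
    simp only [side, det4_eq_rowDet]
    refine ContinuousAt.comp_continuousWithinAt
      (f := fun s => ![(x s (K.vert f 0) : E4), x s (K.vert f 1), x s (K.vert f 2), q])
      (rowDetMultilinear 4).cont.continuousAt ?_
    refine continuousWithinAt_pi.2 fun i => ?_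
    fin_cases i
    exacts [hv _, hv _, hv _, continuousWithinAt_const]
  exact hc.eventually_ne (hq f)

/-- The class of the oriented volume is constant in the course of a deformation that leaves the
dihedral angles fixed. -/
theorem orientedVolume_class_eq [Fintype F] {I : Set ℝ} (hI : I.OrdConnected) {x : ℝ → V → S3}
    (hx : K.IsSmoothDeformation I x) (hangle : K.PreservesDihedralAngles I x) {s t : ℝ}
    (hs : s ∈ I) (ht : t ∈ I) {p q : S3} (hp : K.IsGeneric (x s) p) (hq : K.IsGeneric (x t) q) :
    (K.orientedVolume (x s) p : AddCircle (2 * Real.pi ^ 2)) = K.orientedVolume (x t) q := by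
  have : PreconnectedSpace I := Subtype.preconnectedSpace hI.isPreconnected
  -- No single apex need be generic at all times. The class does not depend on the choice of `r`, so
  -- local constancy can be tested with the apex of one time.
  choose r hr using fun s : I => (hx.2 s s.2).exists_isGeneric
  let Θ : I → AddCircle (2 * Real.pi ^ 2) := fun s => (K.orientedVolume (x s) (r s) : ℝ)
  have hΘ : IsLocallyConstant Θ := by
    rw [IsLocallyConstant.iff_eventually_eq]
    intro t
    have h1 := K.eventually_isGeneric hx t.2 (hr t)
    -- Genericity is needed on the whole segment between the two times; the ball supplies it.
    obtain ⟨ε, hε, hball⟩ := Metric.mem_nhdsWithin_iff.1 h1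
    have hball' : ∀ y ∈ I, |y - t| < ε → K.IsGeneric (x y) (r t) :=
      fun y hy hd => hball ⟨by rwa [Metric.mem_ball, Real.dist_eq], hy⟩
    filter_upwards [Metric.ball_mem_nhds t hε] with s hs
    rw [Metric.mem_ball, Subtype.dist_eq, Real.dist_eq] at hs
    have h2 : K.orientedVolume (x s) (r t) = K.orientedVolume (x t) (r t) := by
      rcases lt_trichotomy (s : ℝ) t with h | h | h
      · refine K.orientedVolume_eq_of_Icc hx hangle h (hI.out s.2 t.2) fun y hy => ?_
        refine hball' y (hI.out s.2 t.2 hy) (lt_of_le_of_lt ?_ hs)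
        rw [abs_of_nonpos (by linarith [hy.2]), abs_of_nonpos (by linarith)]
        linarith [hy.1]
      · rw [h]
      · refine (K.orientedVolume_eq_of_Icc hx hangle h (hI.out t.2 s.2) fun y hy => ?_).symm
        refine hball' y (hI.out t.2 s.2 hy) (lt_of_le_of_lt ?_ hs)
        rw [abs_of_nonneg (by linarith [hy.1]), abs_of_nonneg (by linarith)]
        linarith [hy.2]
    change ((K.orientedVolume (x s) (r s) : ℝ) : AddCircle (2 * Real.pi ^ 2)) = _
    rw [K.orientedVolume_eq_of_isGeneric (hx.2 s s.2) (hr s) (hball' s s.2 hs), h2]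
  rw [K.orientedVolume_eq_of_isGeneric (hx.2 s hs) hp (hr ⟨s, hs⟩),
    K.orientedVolume_eq_of_isGeneric (hx.2 t ht) hq (hr ⟨t, ht⟩)]
  exact hΘ.apply_eq_of_preconnectedSpace ⟨s, hs⟩ ⟨t, ht⟩

end OrientedTriangulation

/-! ### Embedded surfaces and the volume of the domain. -/

theorem rowDet_last_combination (a b c q : E4) (r₀ r₁ r₂ r₃ : ℝ) :
    rowDet ![a, b, c, r₀ • a + r₁ • b + r₂ • c + r₃ • q] = r₃ * rowDet ![a, b, c, q] := by
  simp only [rowDet_vecFour_expand, PiLp.add_apply, PiLp.smul_apply, smul_eq_mul]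
  ring

theorem rowDet_smul_last (a b c : E4) (r : ℝ) (q : E4) :
    rowDet ![a, b, c, r • q] = r * rowDet ![a, b, c, q] := by
  simp only [rowDet_vecFour_expand, PiLp.smul_apply, smul_eq_mul]
  ring

theorem continuous_det4 (a b c : S3) : Continuous fun z => det4 a b c z := by
  simp only [det4_eq_rowDet, rowDet_vecFour_expand]
  fun_prop

namespace OrientedTriangulation

variable {V F : Type*} (K : OrientedTriangulation V F)

theorem mem_face_iff {x : V → S3} {f : F} {y : S3} : y ∈ K.face x f ↔
    ∃ r : Fin 3 → ℝ, (∀ i, 0 ≤ r i) ∧ (y : E4) = ∑ i, r i • (x (K.vert f i) : E4) := by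
  unfold face
  rw [← Set.range_comp, mem_sphericalHull_range]
  rfl

theorem openFace_subset_face {x : V → S3} {f : F} : K.openFace x f ⊆ K.face x f := by
  rintro y ⟨r, hr, h⟩
  exact K.mem_face_iff.2 ⟨r, fun i => (hr i).le, h⟩

theorem insert_range_vert (x : V → S3) (q : S3) (f : F) : insert q (x '' Set.range (K.vert f)) =
    Set.range ![x (K.vert f 0), x (K.vert f 1), x (K.vert f 2), q] := by
  rw [K.range_vert]
  simp only [Matrix.range_cons, Matrix.range_empty, Set.union_empty, Set.singleton_union]
  ext; simp; tauto

theorem mem_tetra_iff {x : V → S3} {q : S3} {f : F} {z : S3} :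
    z ∈ sphericalHull (insert q (x '' Set.range (K.vert f))) ↔
    ∃ (α : ℝ) (r : Fin 3 → ℝ), 0 ≤ α ∧ (∀ i, 0 ≤ r i) ∧
      (z : E4) = α • (q : E4) + ∑ i, r i • (x (K.vert f i) : E4) := by
  rw [K.insert_range_vert, mem_sphericalHull_range]
  constructor
  · rintro ⟨r, hr, h⟩
    refine ⟨r 3, ![r 0, r 1, r 2], hr 3, ?_, ?_⟩
    · intro i; fin_cases i
      exacts [hr 0, hr 1, hr 2]
    · rw [h, Fin.sum_univ_four, Fin.sum_univ_three, add_comm]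
      rfl
  · rintro ⟨α, r, hα, hr, h⟩
    refine ⟨![r 0, r 1, r 2, α], ?_, ?_⟩
    · intro i; fin_cases i
      exacts [hr 0, hr 1, hr 2, hα]
    · rw [h, Fin.sum_univ_four, Fin.sum_univ_three, add_comm]
      rfl

/-- A point with all coordinates positive does not lie in the span of a proper subset of the
vertices. -/
theorem subset_of_mem_openFace {x : V → S3} (hx : K.IsNondegenerate x) {f : F} {A : Set V}
    {y : S3} (hf : y ∈ K.openFace x f)
    (hy : y ∈ sphericalHull (x '' (Set.range (K.vert f) ∩ A))) : Set.range (K.vert f) ⊆ A := by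
  rintro _ ⟨i, rfl⟩
  by_contra hi
  obtain ⟨r, hr, h⟩ := hf
  set u : Fin 3 → E4 := fun j => (x (K.vert f j) : E4)
  have hyW : (y : E4) ∈ Submodule.span ℝ (u '' {i}ᶜ) := by
    refine Submodule.span_mono ?_ (Submodule.span_subset_span NNReal ℝ _ hy)
    rintro _ ⟨_, ⟨v, ⟨⟨j, rfl⟩, hj⟩, rfl⟩, rfl⟩
    exact ⟨j, fun hji => hi (by rw [← Set.mem_singleton_iff.1 hji]; exact hj), rfl⟩
  have h2 : r i • u i ∈ Submodule.span ℝ (u '' {i}ᶜ) := by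
    have : r i • u i = (y : E4) - ∑ j ∈ Finset.univ.erase i, r j • u j := by
      rw [h, ← Finset.add_sum_erase _ _ (Finset.mem_univ i)]; simp [u]
    rw [this]
    refine Submodule.sub_mem _ hyW (Submodule.sum_mem _ fun j hj => ?_)
    exact Submodule.smul_mem _ _ (Submodule.subset_span ⟨j, by simpa using hj, rfl⟩)
  have h3 : u i ∈ Submodule.span ℝ (u '' {i}ᶜ) := (Submodule.smul_mem_iff _ (hr i).ne').1 h2
  exact (hx f).notMem_span_image (s := {i}ᶜ) (by simp) h3

/-- The interiors of different triangles of an embedded surface are disjoint. -/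
theorem IsEmbedded.eq_of_mem_openFace {K : OrientedTriangulation V F} {x : V → S3}
    (hemb : K.IsEmbedded x) (hx : K.IsNondegenerate x) {f g : F} {y : S3}
    (hf : y ∈ K.openFace x f) (hg : y ∈ K.openFace x g) : f = g := by
  have h := hemb f g ⟨K.openFace_subset_face hf, K.openFace_subset_face hg⟩
  refine K.eq_of_range_eq f g (Set.Subset.antisymm (K.subset_of_mem_openFace hx hf h) ?_)
  rw [Set.inter_comm] at h
  exact K.subset_of_mem_openFace hx hg h

/-- Coordinates of a point in general position are positive as soon as they are nonnegative. -/
theorem coords_pos_of_generic {x : V → S3} {q z : S3} {f : F} (hz : K.side x f z ≠ 0)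
    (hzq : ∀ i, det4 (x (K.vert f i)) (x (K.vert f (i + 1))) q z ≠ 0)
    {α : ℝ} {r : Fin 3 → ℝ} (hα : 0 ≤ α) (hr : ∀ i, 0 ≤ r i)
    (h : (z : E4) = α • (q : E4) + ∑ i, r i • (x (K.vert f i) : E4)) :
    0 < α ∧ (∀ i, 0 < r i) ∧ K.side x f z = α * K.side x f q := by
  have hside : K.side x f z = α * K.side x f q := by
    simp only [side, det4_eq_rowDet]
    rw [h, Fin.sum_univ_three, add_comm, rowDet_last_combination]
  refine ⟨hα.lt_of_ne fun h0 => hz (by rw [hside, ← h0, zero_mul]), fun i => ?_, hside⟩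
  -- The edge that starts at `i + 1` is the one that omits the vertex `i`.
  refine (hr i).lt_of_ne fun h0 => hzq (i + 1) ?_
  have hz' : (z : E4) = r (i + 1) • (x (K.vert f (i + 1)) : E4)
      + r (i + 1 + 1) • (x (K.vert f (i + 1 + 1)) : E4) + α • (q : E4)
      + r i • (x (K.vert f i) : E4) := by
    rw [h, Fin.sum_univ_three]
    fin_cases i <;> (simp; abel)
  rw [det4_eq_rowDet, hz', ← h0]
  exact (rowDet_last_combination _ _ _ _ _ _ _ 0).trans (zero_mul _)

theorem Bounds.eventually_iff_of_notMem {K : OrientedTriangulation V F} {x : V → S3} {D : Set S3}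
    (hD : K.Bounds x D) {y : S3} (hy : y ∉ K.carrier x) : ∀ᶠ z in 𝓝 y, (z ∈ D ↔ y ∈ D) := by
  by_cases h : y ∈ D
  · filter_upwards [hD.isOpen.mem_nhds h] with z hz
    simp [hz, h]
  · have hc : y ∉ closure D := fun hc => hy (by
      rw [← hD.frontier_eq, frontier, hD.isOpen.interior_eq]; exact ⟨hc, h⟩)
    filter_upwards [isClosed_closure.isOpen_compl.mem_nhds hc] with z hz
    simp only [h, iff_false]
    exact fun hzD => hz (subset_closure hzD)

/-- The signed number of the tetrahedra with apex `q` that contain a point in general position. -/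
theorem sum_sign_indicator_tetra [Fintype F] {x : V → S3} {D : Set S3}
    (hx : K.IsNondegenerate x) (hemb : K.IsEmbedded x) (hD : K.Bounds x D) {q z : S3}
    (hq : K.IsGeneric x q) (hz : K.IsGeneric x z) (hqz : ∀ s t : ℝ, s • (z : E4) = t • (q : E4) →
      s = 0 ∧ t = 0)
    (hzq : ∀ f i, det4 (x (K.vert f i)) (x (K.vert f (i + 1))) q z ≠ 0) :
    ∑ f, (SignType.sign (-K.side x f q) : ℝ) *
        (sphericalHull (insert q (x '' Set.range (K.vert f)))).indicator 1 z
      = D.indicator 1 z - D.indicator 1 (-q) := by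
  classical
  set C : Finset F := {f | z ∈ sphericalHull (insert q (x '' Set.range (K.vert f)))} with hC
  -- The great arc from `z` to `-q`, directed away from `q`. It meets exactly the triangles whose
  -- tetrahedra contain `z`.
  let u : unitInterval → E4 := fun s => (1 - (s : ℝ)) • (z : E4) - (s : ℝ) • (q : E4)
  have hu0 : ∀ s, 0 < ‖u s‖ := fun s => norm_pos_iff.2 fun h => by
    have := hqz _ _ (sub_eq_zero.1 h)
    linarith [this.1, this.2]
  let γ : unitInterval → S3 := fun s => ⟨‖u s‖⁻¹ • u s, by
    rw [mem_sphere_zero_iff_norm, norm_smul, norm_inv, norm_norm, inv_mul_cancel₀ (hu0 s).ne']⟩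
  have huc : Continuous u := by fun_prop
  have hγ : Continuous γ :=
    ((huc.norm.inv₀ fun s => (hu0 s).ne').smul huc).subtype_mk _
  have hγu : ∀ s, u s = ‖u s‖ • (γ s : E4) := fun s => (smul_inv_smul₀ (hu0 s).ne' _).symm
  have hγ0 : γ 0 = z := by ext1; simp [γ, u]
  have hγ1 : γ 1 = -q := by ext1; simp [γ, u]
  -- For `f ∈ C` the arc crosses the great sphere of `f` only inside the open triangle: where `side`
  -- vanishes, the component along `q` drops out.
  have hpos : ∀ f ∈ C, ∃ α > 0, K.side x f z = α * K.side x f q ∧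
      ∀ s, K.side x f (γ s) = 0 → γ s ∈ K.openFace x f := fun f hf => by
    obtain ⟨α, r, hα, hr, h⟩ := K.mem_tetra_iff.1 (Finset.mem_filter.1 hf).2
    obtain ⟨hα', hr', hside⟩ := K.coords_pos_of_generic (hz f) (hzq f) hα hr h
    refine ⟨α, hα', hside, fun s hs => ?_⟩
    have h1 : ‖u s‖ * K.side x f (γ s) = ((1 - s) * α - s) * K.side x f q := by
      have e : u s = ((1 - (s : ℝ)) * r 0) • (x (K.vert f 0) : E4)
          + ((1 - (s : ℝ)) * r 1) • (x (K.vert f 1) : E4)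
          + ((1 - (s : ℝ)) * r 2) • (x (K.vert f 2) : E4)
          + ((1 - (s : ℝ)) * α - s) • (q : E4) := by
        simp only [u, h, Fin.sum_univ_three]
        module
      simp only [side, det4_eq_rowDet]
      rw [← rowDet_smul_last, ← hγu, e]
      exact rowDet_last_combination _ _ _ _ _ _ _ _
    rw [hs, mul_zero, eq_comm, mul_eq_zero] at h1
    have h2 : (1 - (s : ℝ)) * α = s := by linarith [h1.resolve_right (hq f)]
    have hs1 : 0 < 1 - (s : ℝ) := by
      refine (sub_nonneg.2 s.2.2).lt_of_ne fun h0 => ?_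
      rw [← h0] at h2
      linarith
    refine ⟨fun i => ‖u s‖⁻¹ * ((1 - s) * r i), fun i =>
      mul_pos (inv_pos.2 (hu0 s)) (mul_pos hs1 (hr' i)), ?_⟩
    change ‖u s‖⁻¹ • u s = _
    simp_rw [mul_smul]
    rw [← Finset.smul_sum, ← Finset.smul_sum]
    congr 1
    simp only [u]
    nth_rewrite 2 [← h2]
    rw [h]
    module
  -- Conversely, every triangle met by the arc belongs to `C` and is met in its interior, since `z`
  -- is in general position to the edges and `q`.
  have hface : ∀ s f, γ s ∈ K.face x f → f ∈ C ∧ γ s ∈ K.openFace x f := fun s f hf => by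
    obtain ⟨r, hr, h⟩ := K.mem_face_iff.1 hf
    have h1 : u s = ∑ i, (‖u s‖ * r i) • (x (K.vert f i) : E4) := by
      simp_rw [mul_smul]
      rw [← Finset.smul_sum, ← h]
      exact hγu s
    have hs1 : 0 < 1 - (s : ℝ) := by
      refine (sub_nonneg.2 s.2.2).lt_of_ne fun h0 => ?_
      have hs : s = 1 := Subtype.ext (by simpa using (by linarith : (s : ℝ) = 1))
      refine hq f ?_
      rw [hs, hγ1, coe_neg_sphere, neg_eq_iff_eq_neg] at h
      simp only [side, det4_eq_rowDet]
      have e : (q : E4) = (-r 0) • (x (K.vert f 0) : E4) + (-r 1) • (x (K.vert f 1) : E4)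
          + (-r 2) • (x (K.vert f 2) : E4) + (0 : ℝ) • (q : E4) := by
        nth_rewrite 1 [h]
        rw [Fin.sum_univ_three]
        module
      rw [e]
      exact (rowDet_last_combination _ _ _ _ _ _ _ 0).trans (zero_mul _)
    have h2 : (z : E4) = ((s : ℝ) / (1 - s)) • (q : E4)
        + ∑ i, ((1 - (s : ℝ))⁻¹ * (‖u s‖ * r i)) • (x (K.vert f i) : E4) := by
      simp_rw [mul_smul (1 - (s : ℝ))⁻¹]
      rw [← Finset.smul_sum, ← h1, div_eq_inv_mul, mul_smul, ← smul_add]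
      simp only [u]
      rw [add_sub_cancel, inv_smul_smul₀ hs1.ne']
    have hα : 0 ≤ (s : ℝ) / (1 - s) := div_nonneg s.2.1 hs1.le
    have hr' : ∀ i, 0 ≤ (1 - (s : ℝ))⁻¹ * (‖u s‖ * r i) := fun i =>
      mul_nonneg (inv_nonneg.2 hs1.le) (mul_nonneg (hu0 s).le (hr i))
    refine ⟨Finset.mem_filter.2 ⟨Finset.mem_univ f, K.mem_tetra_iff.2 ⟨_, _, hα, hr', h2⟩⟩,
      r, fun i => ?_, h⟩
    have := (K.coords_pos_of_generic (hz f) (hzq f) hα hr' h2).2.1 i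
    exact pos_of_mul_pos_right (pos_of_mul_pos_right this (inv_nonneg.2 hs1.le)) (hu0 s).le
  let N : F → Set S3 := fun f => {y | K.side x f y < 0}
  have hNc : ∀ f y, K.side x f y ≠ 0 → ∀ᶠ y' in 𝓝 y,
      (N f).indicator (1 : S3 → ℝ) y' = (N f).indicator 1 y := fun f y hy => by
    have hcont : Continuous (K.side x f) := continuous_det4 _ _ _
    rcases lt_or_gt_of_ne hy with h | h
    · filter_upwards [hcont.continuousAt.eventually_lt_const h] with y' hy'
      rw [Set.indicator_of_mem (show y' ∈ N f from hy'), Set.indicator_of_mem (show y ∈ N f from h)]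
      rfl
    · filter_upwards [hcont.continuousAt.eventually_const_lt h] with y' hy'
      rw [Set.indicator_of_notMem (show y' ∉ N f from not_lt.2 (le_of_lt hy')),
        Set.indicator_of_notMem (show y ∉ N f from not_lt.2 (le_of_lt h))]
  -- On a triangle `f` the indicator of `D` jumps just as that of the negative side `N f`, and no
  -- other `g ∈ C` is crossed there because open triangles are disjoint. Hence `Ψ` has no jumps.
  let Ψ : unitInterval → ℝ := fun s =>
    D.indicator 1 (γ s) - ∑ f ∈ C, (N f).indicator (1 : S3 → ℝ) (γ s)
  have hΨ : IsLocallyConstant Ψ := by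
    rw [IsLocallyConstant.iff_eventually_eq]
    intro s
    by_cases hs : γ s ∈ K.carrier x
    · obtain ⟨f, hf⟩ := Set.mem_iUnion.1 hs
      obtain ⟨hfC, hfo⟩ := hface s f hf
      have hother : ∀ g ∈ C.erase f, ∀ᶠ y in 𝓝 (γ s),
          (N g).indicator (1 : S3 → ℝ) y = (N g).indicator 1 (γ s) := fun g hg => by
        refine hNc g _ fun h0 => ?_
        obtain ⟨-, -, -, hgo⟩ := hpos g (Finset.mem_of_mem_erase hg)
        exact Finset.ne_of_mem_erase hg (hemb.eq_of_mem_openFace hx (hgo s h0) hfo)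
      have hev := (Filter.eventually_all_finset _).2 hother
      have hor := hD.orientation f _ hfo
      have hsame := hor.self_of_nhds
      have hDN : ∀ y, (y ∈ D ↔ K.side x f y < 0) →
          D.indicator (1 : S3 → ℝ) y = (N f).indicator 1 y := fun y hy => by
        by_cases h : y ∈ D
        · rw [Set.indicator_of_mem h, Set.indicator_of_mem (show y ∈ N f from hy.1 h)]
        · rw [Set.indicator_of_notMem h, Set.indicator_of_notMem (show y ∉ N f from mt hy.2 h)]
      have hboth := hγ.continuousAt.eventually (hev.and hor)
      filter_upwards [hboth] with s' hs'
      simp only [Ψ]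
      rw [← Finset.add_sum_erase _ _ hfC, ← Finset.add_sum_erase _ _ hfC, hDN _ hs'.2,
        hDN _ hsame, Finset.sum_congr rfl hs'.1]
      ring
    · have hall : ∀ g ∈ C, ∀ᶠ y in 𝓝 (γ s),
          (N g).indicator (1 : S3 → ℝ) y = (N g).indicator 1 (γ s) := fun g hg => by
        refine hNc g _ fun h0 => hs (Set.mem_iUnion.2 ⟨g, K.openFace_subset_face ?_⟩)
        obtain ⟨-, -, -, hgo⟩ := hpos g hg
        exact hgo s h0
      have hev := (Filter.eventually_all_finset _).2 hall
      have hboth := hγ.continuousAt.eventually (hev.and (hD.eventually_iff_of_notMem hs))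
      filter_upwards [hboth] with s' hs'
      simp only [Ψ]
      rw [Finset.sum_congr rfl hs'.1]
      congr 1
      simp only [Set.indicator_apply, hs'.2]
      rfl
  have h01 := hΨ.apply_eq_of_preconnectedSpace 0 1
  simp only [Ψ, hγ0, hγ1] at h01
  -- For `f ∈ C` the point `z` lies on the side of `q` and `-q` on the other one, so the sign is the
  -- change of the indicator of `N f` along the arc.
  have hsum : ∑ f, (SignType.sign (-K.side x f q) : ℝ) *
        (sphericalHull (insert q (x '' Set.range (K.vert f)))).indicator 1 z
      = ∑ f ∈ C, ((N f).indicator (1 : S3 → ℝ) z - (N f).indicator 1 (-q)) := by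
    rw [hC, Finset.sum_filter]
    refine Finset.sum_congr rfl fun f _ => ?_
    by_cases hf : z ∈ sphericalHull (insert q (x '' Set.range (K.vert f)))
    · rw [if_pos hf, Set.indicator_of_mem hf, Pi.one_apply, mul_one]
      obtain ⟨α, hα, hside, -⟩ := hpos f (Finset.mem_filter.2 ⟨Finset.mem_univ f, hf⟩)
      have hneg : K.side x f (-q) = -K.side x f q := by
        simp only [side, det4_eq_rowDet, coe_neg_sphere]
        rw [← neg_one_smul ℝ (q : E4), rowDet_smul_last]
        ring
      rcases lt_or_gt_of_ne (hq f) with h | h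
      · have h1 : z ∈ N f := by
          change K.side x f z < 0
          rw [hside]; exact mul_neg_of_pos_of_neg hα h
        have h2 : -q ∉ N f := by
          change ¬ K.side x f (-q) < 0
          rw [hneg]; linarith
        rw [Set.indicator_of_mem h1, Set.indicator_of_notMem h2, sign_pos (neg_pos.2 h)]
        simp
      · have h1 : z ∉ N f := by
          change ¬ K.side x f z < 0
          rw [hside]; exact not_lt.2 (mul_pos hα h).le
        have h2 : -q ∈ N f := by
          change K.side x f (-q) < 0
          rw [hneg]; linarith
        rw [Set.indicator_of_notMem h1, Set.indicator_of_mem h2, sign_neg (neg_lt_zero.2 h)]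
        simp
    · rw [if_neg hf, Set.indicator_of_notMem hf, mul_zero]
  rw [hsum, Finset.sum_sub_distrib]
  linarith

/-- The oriented volume of an embedded surface is the volume of the domain that it bounds. -/
theorem orientedVolume_class_eq_sphereVolume [Fintype F] [Nonempty V] {x : V → S3} {D : Set S3}
    (hx : K.IsNondegenerate x) (hemb : K.IsEmbedded x) (hD : K.Bounds x D) {q : S3}
    (hq : K.IsGeneric x q) :
    (K.orientedVolume x q : AddCircle (2 * Real.pi ^ 2)) = (sphereVolume.real D : ℝ) := by
  have hae : ∀ᵐ z ∂sphereVolume, ∑ f, (SignType.sign (-K.side x f q) : ℝ) *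
        (sphericalHull (insert q (x '' Set.range (K.vert f)))).indicator 1 z
      = D.indicator 1 z - D.indicator 1 (-q) := by
    have h1 : ∀ᵐ z ∂sphereVolume, ∀ f i,
        det4 (x (K.vert f i)) (x (K.vert f (i + 1))) q z ≠ 0 := by
      rw [ae_all_iff]; intro f
      rw [ae_all_iff]; intro i
      refine ae_det4_ne_zero ?_
      convert (hq.linearIndependent f i).comp ![0, 1, 3] (by decide) using 1
      ext j : 1; fin_cases j <;> rfl
    filter_upwards [hx.ae_isGeneric, h1] with z hz hzq
    refine K.sum_sign_indicator_tetra hx hemb hD hq hz (fun s t hst => ?_) hzq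
    obtain ⟨f, i, -⟩ := K.exists_vert_eq (Classical.arbitrary V)
    have hli := det4_ne_zero_iff.1 (hzq f i)
    have := Fintype.linearIndependent_iff.1 hli ![0, 0, -t, s] (by
      simp [Fin.sum_univ_four, hst])
    exact ⟨this 3, by simpa using this 2⟩
  have hm : ∀ f, MeasurableSet (sphericalHull (insert q (x '' Set.range (K.vert f)))) :=
    fun f => by
      rw [K.insert_range_vert]
      refine (isClosed_sphericalHull_range ?_).measurableSet
      rw [coe_vecFour]
      exact det4_ne_zero_iff.1 (hq f)
  have hmD := hD.isOpen.measurableSet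
  -- Integration of the signed count over `z`; the constant `D.indicator 1 (-q)` contributes zero or
  -- one full sphere.
  have hvol : K.orientedVolume x q
      = sphereVolume.real D - D.indicator 1 (-q) * (2 * Real.pi ^ 2) := by
    have h2 : K.orientedVolume x q = ∫ z, ∑ f, (SignType.sign (-K.side x f q) : ℝ) *
        (sphericalHull (insert q (x '' Set.range (K.vert f)))).indicator 1 z ∂sphereVolume := by
      rw [integral_finsetSum]
      · refine Finset.sum_congr rfl fun f _ => ?_
        rw [integral_const_mul, integral_indicator_one (hm f)]
      · exact fun f _ => ((integrable_const (1 : ℝ)).indicator (hm f)).const_mul _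
    have h3 : Integrable (D.indicator (1 : S3 → ℝ)) sphereVolume :=
      (integrable_const (1 : ℝ)).indicator hmD
    rw [h2, integral_congr_ae hae, integral_sub h3 (integrable_const _), integral_indicator_one hmD, integral_const, sphereVolume_univ,
      smul_eq_mul, mul_comm (2 * Real.pi ^ 2)]
  rw [hvol, AddCircle.coe_sub, sub_eq_self]
  by_cases h : -q ∈ D
  · rw [Set.indicator_of_mem h, Pi.one_apply, one_mul, AddCircle.coe_period]
  · rw [Set.indicator_of_notMem h, zero_mul]; rfl

/-- The empty set has empty frontier, but the surface contains its vertices. -/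
theorem Bounds.sphereVolume_pos [Nonempty V] {K : OrientedTriangulation V F} {x : V → S3}
    {D : Set S3} (hD : K.Bounds x D) : 0 < sphereVolume.real D := by
  refine ENNReal.toReal_pos (hD.isOpen.measure_ne_zero _ ?_) (measure_ne_top _ _)
  rw [Set.nonempty_iff_ne_empty]
  rintro rfl
  obtain ⟨f, i, -⟩ := K.exists_vert_eq (Classical.arbitrary V)
  have h : x (K.vert f i) ∈ K.carrier x :=
    Set.mem_iUnion.2 ⟨f, Submodule.subset_span ⟨_, ⟨_, ⟨i, rfl⟩, rfl⟩, rfl⟩⟩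
  rw [← hD.frontier_eq, frontier_empty] at h
  exact h

end OrientedTriangulation

theorem theorem5 {V F : Type*} [Fintype V] [Fintype F] [Nonempty V]
    (K : OrientedTriangulation V F) (I : Set ℝ) (hI : I.OrdConnected) (x : ℝ → V → S3)
    (hx : K.IsSmoothDeformation I x) (hangle : K.PreservesDihedralAngles I x) :
    (∀ s ∈ I, ∀ t ∈ I, ∀ p q : S3, K.IsGeneric (x s) p → K.IsGeneric (x t) q →
      (K.orientedVolume (x s) p : AddCircle (2 * Real.pi ^ 2)) =
        (K.orientedVolume (x t) q : AddCircle (2 * Real.pi ^ 2))) ∧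
    ∀ D : ℝ → Set S3, (∀ t ∈ I, K.IsEmbedded (x t) ∧ K.Bounds (x t) (D t)) →
      ∀ s ∈ I, ∀ t ∈ I, sphereVolume (D s) = sphereVolume (D t) := by
  refine ⟨fun s hs t ht p q hp hq => K.orientedVolume_class_eq hI hx hangle hs ht hp hq,
    fun D hD s hs t ht => ?_⟩
  obtain ⟨p, hp⟩ := (hx.2 s hs).exists_isGeneric
  obtain ⟨q, hq⟩ := (hx.2 t ht).exists_isGeneric
  have h := K.orientedVolume_class_eq hI hx hangle hs ht hp hq
  rw [K.orientedVolume_class_eq_sphereVolume (hx.2 s hs) (hD s hs).1 (hD s hs).2 hp,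
    K.orientedVolume_class_eq_sphereVolume (hx.2 t ht) (hD t ht).1 (hD t ht).2 hq] at h
  have : Fact (0 < 2 * Real.pi ^ 2) := ⟨by positivity⟩
  have hle : ∀ A : Set S3, sphereVolume.real A ≤ 2 * Real.pi ^ 2 := fun A =>
    sphereVolume_univ ▸ measureReal_mono (Set.subset_univ A)
  -- Excluding zero matters: `0` and `2π²` have the same class, and the half-open interval contains
  -- only one of them.
  have hmem : ∀ {t}, t ∈ I → sphereVolume.real (D t) ∈ Set.Ioc 0 (0 + 2 * Real.pi ^ 2) :=
    fun {t} ht => ⟨(hD t ht).2.sphereVolume_pos, by rw [zero_add]; exact hle _⟩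
  have hreal : sphereVolume.real (D s) = sphereVolume.real (D t) := by
    rw [← sub_eq_zero]
    rw [← sub_eq_zero, ← AddCircle.coe_sub, AddCircle.coe_eq_zero_iff] at h
    obtain ⟨n, hn⟩ := h
    have h1 := hmem hs
    have h2 := hmem ht
    rw [zsmul_eq_mul] at hn
    have hpi : 0 < 2 * Real.pi ^ 2 := by positivity
    have hn1 : (n : ℝ) < 1 := by
      by_contra hc
      have := mul_le_mul_of_nonneg_right (not_lt.1 hc) hpi.le
      linarith [h1.2, h2.1]
    have hn2 : (-1 : ℝ) < n := by
      by_contra hc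
      have := mul_le_mul_of_nonneg_right (not_lt.1 hc) hpi.le
      linarith [h1.1, h2.2]
    have hn0 : n = 0 := by
      have a1 : n < 1 := by exact_mod_cast hn1
      have a2 : -1 < n := by exact_mod_cast hn2
      omega
    rw [← hn, hn0]; simp
  exact (ENNReal.toReal_eq_toReal_iff' (measure_ne_top _ _) (measure_ne_top _ _)).1 hreal
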